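/- **Setting.** A cell-free network has $M$ access points (APs) with $N$ antennas each, $K$ single-antenna users with uplink powers $p_l\ge 0$, noise power $\sigma^2>0$, and $\tau_p$ mutually orthogonal pilots of length $\tau_p$; $\mathcal P_k$ is the set of users that send the same pilot as user $k$ (including $k$). The channels are $\mathbf g_{ml}=\bar{\mathbf g}_{ml}+\check{\mathbf g}_{ml}\in\mathbb C^N$ with $\bar{\mathbf g}_{ml}$ deterministic and $\check{\mathbf g}_{ml}\sim\mathcal N_{\mathbb C}(\mathbf 0,\check{\mathbf R}_{ml})$ (circularly symmetric). The despread pilot signal is $\mathbf y_{mk}^p=\sum_{l\in\mathcal P_k}\sqrt{p_l}\,\tau_p\mathbf g_{ml}+\mathbf n_{mk}^p$ with $\mathbf n^p_{mk}\sim\mathcal N_{\mathbb C}(\mathbf 0,\tau_p\sigma^2\mathbf I_N)$; for each $k$, all the $\check{\mathbf g}_{ml}$ and $\mathbf n^p_{1k},\dots,\mathbf n^p_{Mk}$ are mutually independent. With arbitrary deterministic $\mathbf A_{mk}\in\mathbb C^{N\times N}$ and $\bar{\mathbf y}_{mk}^p=\sum_{l\in\mathcal P_k}\sqrt{p_l}\,\tau_p\bar{\mathbf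 g}_{ml}$, the channel estimate is $\hat{\mathbf g}_{mk}=\bar{\mathbf g}_{mk}+\mathbf A_{mk}(\mathbf y^p_{mk}-\bar{\mathbf y}^p_{mk})$. Put $\mathbf\Psi_{mk}=\sum_{l\in\mathcal P_k}p_l\tau_p\check{\mathbf R}_{ml}+\sigma^2\mathbf I_N$. For combining vectors $\mathbf v_{mk}$, the uplink SINR of user $k$ is $$\mathrm{SINR}^{\rm ul}_k=\frac{p_k|\sum_m\mathbb E\{\mathbf v_{mk}^H\mathbf g_{mk}\}|^2}{\sum_{l}p_l\mathbb E\{|\sum_m\mathbf v_{mk}^H\mathbf g_{ml}|^2\}-p_k|\sum_m\mathbb E\{\mathbf v_{mk}^H\mathbf g_{mk}\}|^2+\sigma^2\sum_m\mathbb E\{\|\mathbf v_{mk}\|^2\}} ,$$ and bilinear equalizers are the choices $\mathbf v_{mk}=\mathbf W_{mk}\hat{\mathbf g}_{mk}$ with deterministic $\mathbf W_{mk}\in\mathbb C^{N\times N}$ (for vanishing combining vectors, the value is read as $0$). Let $\mathbf q_{kl}\in\mathbb C^{MN^2}$ have the blocks $\mathrm{vec}(\mathbf g_{ml}\hat{\mathbf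 g}_{mk}^H)$, $m=1,\dots,M$, let $\mathbf p_k=\mathbf q_{kk}$, $\mathbf\Xi_k=\mathrm{diag}(\mathbb E\{\hat{\mathbf g}_{mk}\hat{\mathbf g}_{mk}^H\}^T\otimes\mathbf I_N)_{m}$ and $\mathbf D_k=\sum_{l=1}^K p_l\mathbb E\{\mathbf q_{kl}\mathbf q_{kl}^H\}-p_k\mathbb E\{\mathbf p_k\}\mathbb E\{\mathbf p_k\}^H+\sigma^2\mathbf\Xi_k$. The OBE vector is $\mathbf w_k^*=\mathbf D_k^{-1}\mathbb E\{\mathbf p_k\}$, the OBE matrices are $\mathbf W^*_{mk}=\mathrm{vec}^{-1}(\mathbf w^*_{mk})$ with $\mathbf w^*_{mk}$ the $m$-th block of $\mathbf w^*_k$, and $\mathrm{SINR}_k^{\rm ul,*}=p_k\mathbb E\{\mathbf p_k\}^H\mathbf D_k^{-1}\mathbb E\{\mathbf p_k\}$. **Theorem.** For every user $k$, all these expectations exist, $\mathbb E\{\mathbf p_k\}=\bar{\mathbf r}_k$, and $$\mathbf D_k=\sum_{l=1}^K(\mathbf\Gamma^{(1)}_{kl}+\mathbf\Gamma^{(3)}_{kl})+\sum_{l\in\mathcal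 P_k}(\mathbf\Gamma^{(2)}_{kl}+\mathbf\Gamma^{(4)}_{kl})-p_k\bar{\mathbf r}_k\bar{\mathbf r}_k^H+\sigma^2\mathbf\Gamma^{(5)}_k .$$ If this matrix is invertible, then $\mathbf w^*_k$ and $\mathrm{SINR}^{\rm ul,*}_k$ equal $$\overline{\mathbf w}^*_k=\Big[\sum_{l=1}^K(\mathbf\Gamma^{(1)}_{kl}+\mathbf\Gamma^{(3)}_{kl})+\sum_{l\in\mathcal P_k}(\mathbf\Gamma^{(2)}_{kl}+\mathbf\Gamma^{(4)}_{kl})-p_k\bar{\mathbf r}_k\bar{\mathbf r}_k^H+\sigma^2\mathbf\Gamma^{(5)}_k\Big]^{-1}\bar{\mathbf r}_k,\qquad \overline{\mathrm{SINR}}^{\rm ul}_k=p_k\bar{\mathbf r}_k^H\overline{\mathbf w}^*_k ,$$ and $\overline{\mathrm{SINR}}^{\rm ul}_k$ is the maximum of $\mathrm{SINR}^{\rm ul}_k$ over all bilinear equalizers, attained at the OBE matrices. Here, with $\bar{\mathbf G}_{mkl}=\bar{\mathbf g}_{mk}\bar{\mathbf g}_{ml}^H$, $\mathbf B_{mlk}=\bar{\mathbf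 G}_{mlk}+\sqrt{p_l}\tau_p\check{\mathbf R}_{ml}\mathbf A_{mk}^H$, $\bar{\mathbf R}_{mk}=\mathbf B_{mkk}$, $\bar{\mathbf g}_{mlk}=\mathrm{vec}(\bar{\mathbf G}_{mlk})$, $\tilde{\mathbf r}_{mlk}=\mathrm{vec}(\check{\mathbf R}_{ml}\mathbf A_{mk}^H)$, $\mathbf b_{mlk}=\mathrm{vec}(\mathbf B_{mlk})$, and with $\bar{\mathbf r}_k$, $\bar{\mathbf g}_{lk,(2)}$, $\mathbf b_{lk}\in\mathbb C^{MN^2}$ obtained by stacking $\mathrm{vec}(\bar{\mathbf R}_{mk})$, $\bar{\mathbf g}_{mlk}$, $\mathbf b_{mlk}$ over $m=1,\dots,M$, - $\mathbf\Gamma^{(1)}_{kl}$ is block diagonal with blocks $p_l(\bar{\mathbf G}_{mkk}^T\otimes\bar{\mathbf G}_{mll})+p_l(\bar{\mathbf G}_{mkk}^T\otimes\check{\mathbf R}_{ml})+p_l\tau_p[(\mathbf A_{mk}\mathbf\Psi_{mk}\mathbf A_{mk}^H)^T\otimes\bar{\mathbf G}_{mll}]+p_l\tau_p[(\mathbf A_{mk}\mathbf\Psi_{mk}\mathbf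 A_{mk}^H)^T\otimes\check{\mathbf R}_{ml}]$; - $\mathbf\Gamma^{(2)}_{kl}$ is block diagonal with blocks $p_l[\sqrt{p_l}\tau_p\bar{\mathbf g}_{mlk}\tilde{\mathbf r}_{mlk}^H+\sqrt{p_l}\tau_p\tilde{\mathbf r}_{mlk}\bar{\mathbf g}_{mlk}^H+p_l\tau_p^2\tilde{\mathbf r}_{mlk}\tilde{\mathbf r}_{mlk}^H]$; - $\mathbf\Gamma^{(3)}_{kl}=p_l\big(\bar{\mathbf g}_{lk,(2)}\bar{\mathbf g}_{lk,(2)}^H-\mathrm{diag}(\bar{\mathbf g}_{mlk}\bar{\mathbf g}_{mlk}^H)_m\big)$; - $\mathbf\Gamma^{(4)}_{kl}=p_l\big(\mathbf b_{lk}\mathbf b_{lk}^H-\mathrm{diag}(\mathbf b_{mlk}\mathbf b_{mlk}^H)_m-\bar{\mathbf g}_{lk,(2)}\bar{\mathbf g}_{lk,(2)}^H+\mathrm{diag}(\bar{\mathbf g}_{mlk}\bar{\mathbf g}_{mlk}^H)_m\big)$; - $\mathbf\Gamma^{(5)}_k$ is block diagonal with blocks $(\bar{\mathbf G}_{mkk}+\tau_p\mathbf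 A_{mk}\mathbf\Psi_{mk}\mathbf A_{mk}^H)^T\otimes\mathbf I_N$. -/

import Mathlib

open MeasureTheory ProbabilityTheory Matrix
open scoped Kronecker

noncomputable section

namespace CellFree

/-- `X ∼ N_ℂ(0, R)`: the random vector `X` in `ℂ^N` is a zero-mean circularly symmetric complex
Gaussian vector with covariance matrix `R`, i.e. its law is Gaussian (real and imaginary parts are
jointly Gaussian), `E X = 0`, `E X Xᴴ = R` and `E X Xᵀ = 0`. -/
structure IsComplexGaussian {Ω : Type*} [MeasurableSpace Ω] (P : Measure Ω) {N : ℕ}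
    (X : Ω → Fin N → ℂ) (R : Matrix (Fin N) (Fin N) ℂ) : Prop where
  gaussian : HasGaussianLaw X P
  mean : ∀ i, ∫ ω, X ω i ∂P = 0
  cov : ∀ i j, ∫ ω, X ω i * star (X ω j) ∂P = R i j
  pseudoCov : ∀ i j, ∫ ω, X ω i * X ω j ∂P = 0

/-- Deterministic data of a cell-free network with `M` access points having `N` antennas each, `K`
single-antenna users and `τp` mutually orthogonal pilots of length `τp`. -/
structure Network (M K N τp : ℕ) where
  /-- uplink transmit power of each user -/
  p : Fin K → ℝ
  p_nonneg : ∀ l, 0 ≤ p l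
  /-- the noise power is `σ ^ 2` -/
  σ : ℝ
  σ_pos : 0 < σ
  /-- deterministic LoS component of the channel between an access point and a user -/
  los : Fin M → Fin K → Fin N → ℂ
  /-- correlation matrix of the NLoS component -/
  R : Fin M → Fin K → Matrix (Fin N) (Fin N) ℂ
  /-- matrix of the statistics-based channel estimator -/
  A : Fin M → Fin K → Matrix (Fin N) (Fin N) ℂ
  /-- the pilot that each user sends -/
  pilot : Fin K → Fin τp

/-- The random vectors of the model: NLoS channel components, and noise in the despread pilot
signal that access point `m` forms for user `k`. -/
structure Randomness (Ω : Type*) (M K N : ℕ) where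
  nlos : Fin M → Fin K → Ω → Fin N → ℂ
  noise : Fin M → Fin K → Ω → Fin N → ℂ

variable {Ω : Type*} {M K N τp : ℕ}

/-- Distributional assumptions: `nlos m l ∼ N_ℂ(0, R m l)`, `noise m k ∼ N_ℂ(0, τp σ² I)`, and for
each user `k` all the NLoS components (over all access points and users) and the pilot noises
`noise 1 k, …, noise M k` are mutually independent. Nothing is said about the joint law of
`noise m k` and `noise m k'`; these coincide when users `k` and `k'` share a pilot. -/
structure IsModel [MeasurableSpace Ω] (P : Measure Ω) (S : Network M K N τp)
    (X : Randomness Ω M K N) : Prop where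
  nlos : ∀ m l, IsComplexGaussian P (X.nlos m l) (S.R m l)
  noise : ∀ m k, IsComplexGaussian P (X.noise m k)
    (((τp * S.σ ^ 2 : ℝ) : ℂ) • (1 : Matrix (Fin N) (Fin N) ℂ))
  indep : ∀ k, iIndepFun
    (Sum.elim (fun i : Fin M × Fin K => X.nlos i.1 i.2) (fun m : Fin M => X.noise m k)) P

/-! ### Vectors, block vectors, expectations -/

/-- Index set of `ℂ^(M N²)`. In `((j, i), m)`, the last entry is the number of the block, and
`(j, i)` is the index of the entry in row `i` and column `j` in the column-stacking `vec`. -/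
abbrev Idx (M N : ℕ) := (Fin N × Fin N) × Fin M

/-- The stacked vector `[x_1ᵀ, …, x_Mᵀ]ᵀ`. -/
def stack (x : Fin M → Fin N × Fin N → ℂ) : Idx M N → ℂ := fun i => x i.2 i.1

/-- The matrices `vec⁻¹(w_1), …, vec⁻¹(w_M)` of a stacked vector `w`. -/
def unvec (w : Idx M N → ℂ) (m : Fin M) : Matrix (Fin N) (Fin N) ℂ :=
  Matrix.of fun i j => w ((j, i), m)

/-- The outer product `x yᴴ`. -/
def outer {ι κ : Type*} (x : ι → ℂ) (y : κ → ℂ) : Matrix ι κ ℂ := vecMulVec x (star y)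

/-- Expectation of a random vector. -/
def expVec {ι : Type*} [MeasurableSpace Ω] (P : Measure Ω) (x : Ω → ι → ℂ) : ι → ℂ :=
  fun i => ∫ ω, x ω i ∂P

/-- Expectation of a random matrix. -/
def expMat {ι κ : Type*} [MeasurableSpace Ω] (P : Measure Ω) (x : Ω → Matrix ι κ ℂ) :
    Matrix ι κ ℂ :=
  Matrix.of fun i j => ∫ ω, x ω i j ∂P

/-! ### Channels, estimates and the uplink SINR -/

namespace Network

variable (S : Network M K N τp) (X : Randomness Ω M K N)

/-- `P_k`: the users with the same pilot as user `k`, including `k`. -/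
def copilot (k : Fin K) : Finset (Fin K) := Finset.univ.filter fun l => S.pilot l = S.pilot k

/-- The coefficient `√p_l τ_p`. -/
def amp (l : Fin K) : ℂ := ((Real.sqrt (S.p l) * τp : ℝ) : ℂ)

/-- The channel `g_{ml}`. -/
def g (m : Fin M) (l : Fin K) (ω : Ω) : Fin N → ℂ := S.los m l + X.nlos m l ω

/-- The despread pilot signal `y_{mk}^p`. -/
def pilotSignal (m : Fin M) (k : Fin K) (ω : Ω) : Fin N → ℂ :=
  ∑ l ∈ S.copilot k, S.amp l • S.g X m l ω + X.noise m k ω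

/-- The deterministic part of the despread pilot signal. -/
def pilotMean (m : Fin M) (k : Fin K) : Fin N → ℂ := ∑ l ∈ S.copilot k, S.amp l • S.los m l

/-- The channel estimate `ĝ_{mk}`. -/
def ghat (m : Fin M) (k : Fin K) (ω : Ω) : Fin N → ℂ :=
  S.los m k + S.A m k *ᵥ (S.pilotSignal X m k ω - S.pilotMean m k)

/-- `Ψ_{mk}`. -/
def Psi (m : Fin M) (k : Fin K) : Matrix (Fin N) (Fin N) ℂ :=
  ∑ l ∈ S.copilot k, ((S.p l * τp : ℝ) : ℂ) • S.R m l + ((S.σ ^ 2 : ℝ) : ℂ) • 1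

/-- The uplink SINR of user `k` with the combining vectors `v_1, …, v_M`. -/
def sinr [MeasurableSpace Ω] (P : Measure Ω) (k : Fin K) (v : Fin M → Ω → Fin N → ℂ) : ℝ :=
  S.p k * ‖∑ m, ∫ ω, star (v m ω) ⬝ᵥ S.g X m k ω ∂P‖ ^ 2 /
    (∑ l, S.p l * ∫ ω, ‖∑ m, star (v m ω) ⬝ᵥ S.g X m l ω‖ ^ 2 ∂P
      - S.p k * ‖∑ m, ∫ ω, star (v m ω) ⬝ᵥ S.g X m k ω ∂P‖ ^ 2
      + S.σ ^ 2 * ∑ m, ∫ ω, ∑ i, ‖v m ω i‖ ^ 2 ∂P)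

/-- The bilinear equalizer combining vectors `v_{mk} = W_{mk} ĝ_{mk}`. -/
def combiner (k : Fin K) (W : Fin M → Matrix (Fin N) (Fin N) ℂ) (m : Fin M) (ω : Ω) : Fin N → ℂ :=
  W m *ᵥ S.ghat X m k ω

/-! ### The optimal bilinear equalizer, through expectations -/

/-- `q_{kl}`, with blocks `vec(g_{ml} ĝ_{mk}ᴴ)`. -/
def q (k l : Fin K) (ω : Ω) : Idx M N → ℂ :=
  stack fun m => vec (outer (S.g X m l ω) (S.ghat X m k ω))

/-- `p_k`, with blocks `vec(g_{mk} ĝ_{mk}ᴴ)`. -/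
def pvec (k : Fin K) (ω : Ω) : Idx M N → ℂ :=
  stack fun m => vec (outer (S.g X m k ω) (S.ghat X m k ω))

/-- `Ξ_k`, the block diagonal matrix with blocks `E{ĝ_{mk} ĝ_{mk}ᴴ}ᵀ ⊗ I_N`. -/
def Xi [MeasurableSpace Ω] (P : Measure Ω) (k : Fin K) : Matrix (Idx M N) (Idx M N) ℂ :=
  blockDiagonal fun m =>
    (expMat P fun ω => outer (S.ghat X m k ω) (S.ghat X m k ω))ᵀ ⊗ₖ (1 : Matrix (Fin N) (Fin N) ℂ)

/-- `∑_l p_l E{q_{kl} q_{kl}ᴴ} - p_k E{p_k} E{p_k}ᴴ + σ² Ξ_k`. -/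
def obeMatrix [MeasurableSpace Ω] (P : Measure Ω) (k : Fin K) : Matrix (Idx M N) (Idx M N) ℂ :=
  ∑ l, (S.p l : ℂ) • expMat P (fun ω => outer (S.q X k l ω) (S.q X k l ω))
    - (S.p k : ℂ) • outer (expVec P (S.pvec X k)) (expVec P (S.pvec X k))
    + ((S.σ ^ 2 : ℝ) : ℂ) • S.Xi X P k

/-- The OBE vector `w_k^*`. -/
def obe [MeasurableSpace Ω] (P : Measure Ω) (k : Fin K) : Idx M N → ℂ :=
  (S.obeMatrix X P k)⁻¹ *ᵥ expVec P (S.pvec X k)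

/-- The value `SINR_k^{ul,*}`, expressed through expectations. -/
def sinrStar [MeasurableSpace Ω] (P : Measure Ω) (k : Fin K) : ℂ :=
  (S.p k : ℂ) *
    (star (expVec P (S.pvec X k)) ⬝ᵥ ((S.obeMatrix X P k)⁻¹ *ᵥ expVec P (S.pvec X k)))

/-! ### The closed forms -/

/-- `Ḡ_{mkl} = ḡ_{mk} ḡ_{ml}ᴴ`. -/
def Gbar (m : Fin M) (k l : Fin K) : Matrix (Fin N) (Fin N) ℂ := outer (S.los m k) (S.los m l)

/-- `A_{mk} Ψ_{mk} A_{mk}ᴴ`. -/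
def APA (m : Fin M) (k : Fin K) : Matrix (Fin N) (Fin N) ℂ :=
  S.A m k * S.Psi m k * (S.A m k)ᴴ

/-- `B_{mlk} = Ḡ_{mlk} + √p_l τ_p Ř_{ml} A_{mk}ᴴ`. -/
def B (m : Fin M) (l k : Fin K) : Matrix (Fin N) (Fin N) ℂ :=
  S.Gbar m l k + S.amp l • (S.R m l * (S.A m k)ᴴ)

/-- `R̄_{mk} = Ḡ_{mkk} + √p_k τ_p Ř_{mk} A_{mk}ᴴ`. -/
def Rbar (m : Fin M) (k : Fin K) : Matrix (Fin N) (Fin N) ℂ :=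
  S.Gbar m k k + S.amp k • (S.R m k * (S.A m k)ᴴ)

/-- `r̄_k`, with blocks `vec(R̄_{mk})`. -/
def rbar (k : Fin K) : Idx M N → ℂ := stack fun m => vec (S.Rbar m k)

/-- `ḡ_{mlk} = vec(Ḡ_{mlk})`. -/
def gvec (m : Fin M) (l k : Fin K) : Fin N × Fin N → ℂ := vec (S.Gbar m l k)

/-- `r̃_{mlk} = vec(Ř_{ml} A_{mk}ᴴ)`. -/
def rtil (m : Fin M) (l k : Fin K) : Fin N × Fin N → ℂ := vec (S.R m l * (S.A m k)ᴴ)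

/-- `b_{mlk} = vec(B_{mlk})`. -/
def bvec (m : Fin M) (l k : Fin K) : Fin N × Fin N → ℂ := vec (S.B m l k)

/-- `Γ_{kl}^{(1)}`. -/
def Gamma1 (k l : Fin K) : Matrix (Idx M N) (Idx M N) ℂ :=
  blockDiagonal fun m =>
    (S.p l : ℂ) • ((S.Gbar m k k)ᵀ ⊗ₖ S.Gbar m l l)
      + (S.p l : ℂ) • ((S.Gbar m k k)ᵀ ⊗ₖ S.R m l)
      + ((S.p l * τp : ℝ) : ℂ) • ((S.APA m k)ᵀ ⊗ₖ S.Gbar m l l)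
      + ((S.p l * τp : ℝ) : ℂ) • ((S.APA m k)ᵀ ⊗ₖ S.R m l)

/-- `Γ_{kl}^{(2)}`. -/
def Gamma2 (k l : Fin K) : Matrix (Idx M N) (Idx M N) ℂ :=
  blockDiagonal fun m =>
    (S.p l : ℂ) • (S.amp l • outer (S.gvec m l k) (S.rtil m l k)
      + S.amp l • outer (S.rtil m l k) (S.gvec m l k)
      + ((S.p l * τp ^ 2 : ℝ) : ℂ) • outer (S.rtil m l k) (S.rtil m l k))

/-- `Γ_{kl}^{(3)}`. -/
def Gamma3 (k l : Fin K) : Matrix (Idx M N) (Idx M N) ℂ :=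
  (S.p l : ℂ) •
    (outer (stack fun m => S.gvec m l k) (stack fun m => S.gvec m l k)
      - blockDiagonal fun m => outer (S.gvec m l k) (S.gvec m l k))

/-- `Γ_{kl}^{(4)}`. -/
def Gamma4 (k l : Fin K) : Matrix (Idx M N) (Idx M N) ℂ :=
  (S.p l : ℂ) •
    (outer (stack fun m => S.bvec m l k) (stack fun m => S.bvec m l k)
      - (blockDiagonal fun m => outer (S.bvec m l k) (S.bvec m l k))
      - outer (stack fun m => S.gvec m l k) (stack fun m => S.gvec m l k)
      + blockDiagonal fun m => outer (S.gvec m l k) (S.gvec m l k))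

/-- `Γ_k^{(5)}`. -/
def Gamma5 (k : Fin K) : Matrix (Idx M N) (Idx M N) ℂ :=
  blockDiagonal fun m =>
    (S.Gbar m k k + ((τp : ℝ) : ℂ) • S.APA m k)ᵀ ⊗ₖ (1 : Matrix (Fin N) (Fin N) ℂ)

/-- The matrix that is inverted in the closed form of the OBE vector. -/
def obeMatrixClosed (k : Fin K) : Matrix (Idx M N) (Idx M N) ℂ :=
  ∑ l, (S.Gamma1 k l + S.Gamma3 k l) + ∑ l ∈ S.copilot k, (S.Gamma2 k l + S.Gamma4 k l)
    - (S.p k : ℂ) • outer (S.rbar k) (S.rbar k) + ((S.σ ^ 2 : ℝ) : ℂ) • S.Gamma5 k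

/-- The closed form `w̄_k^*` of the OBE vector. -/
def obeClosed (k : Fin K) : Idx M N → ℂ := (S.obeMatrixClosed k)⁻¹ *ᵥ S.rbar k

end Network

end CellFree

end

/-! Two independent facts combine: a Gaussian fourth-moment computation, which evaluates the OBE
matrix `D`, and a generalized Rayleigh quotient, which is maximized by `D⁻¹ r`.

Moments. For a fixed user `k`, independence makes all NLoS components and pilot noises one jointly
Gaussian vector, and every entry of `g` and `ĝ` is a constant plus a real-linear functional of it.
Isserlis' theorem with means (`integral_const_add_mul_four`) writes a fourth moment as the sum over
the three pairings of products of second moments, minus twice the product of the means. Applied to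
`g ĝ* g* ĝ`, the pairing of `g` with `ĝ` sees only vanishing pseudo-covariances and cancels one of
the two mean products. The pairing of `g` with `ĝ*` gives the rank-one terms, that of `g` with `g*`
the Kronecker terms (`integral_q_mul_star_q`). Sorting by equal or distinct access points and by
shared or different pilots yields the `Γ` matrices.

Optimization. Since `(W ĝ)ᴴ g = vec(W)ᴴ vec(g ĝᴴ)`, the SINR is `p_k |wᴴ r|² / (wᴴ D w)` with `w`
the stacked `vec(W_m)`. By Jensen's inequality `D` is positive semidefinite, so Cauchy-Schwarz for
the form `D` bounds the quotient by `rᴴ D⁻¹ r`, with equality at `D⁻¹ r`. -/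

namespace CellFree

/-! ### Random variables with finite moments of every order -/

/-- All moments of `f` are finite. -/
def FiniteMoments {Ω 𝕜 : Type*} [MeasurableSpace Ω] [NormedAddCommGroup 𝕜] (P : Measure Ω)
    (f : Ω → 𝕜) : Prop :=
  ∀ p : ENNReal, p ≠ ⊤ → MemLp f p P

namespace FiniteMoments

variable {Ω 𝕜 : Type*} [MeasurableSpace Ω] {P : Measure Ω} [RCLike 𝕜] {f g : Ω → 𝕜}

lemma memLp_two (hf : FiniteMoments P f) : MemLp f 2 P := hf 2 (by simp)

lemma integrable (hf : FiniteMoments P f) : Integrable f P :=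
  memLp_one_iff_integrable.1 (hf 1 (by simp))

lemma add (hf : FiniteMoments P f) (hg : FiniteMoments P g) :
    FiniteMoments P fun ω => f ω + g ω :=
  fun p hp => (hf p hp).add (hg p hp)

lemma sub (hf : FiniteMoments P f) (hg : FiniteMoments P g) :
    FiniteMoments P fun ω => f ω - g ω :=
  fun p hp => (hf p hp).sub (hg p hp)

/-- Hölder with exponents `2p, 2p`. Closure under products is the reason to ask for all finite
exponents at once: every polynomial below is then integrable without tracking orders. -/
lemma mul (hf : FiniteMoments P f) (hg : FiniteMoments P g) :
    FiniteMoments P fun ω => f ω * g ω := by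
  intro p hp
  have : ENNReal.HolderTriple (2 * p) (2 * p) p := ⟨by
    rw [ENNReal.mul_inv (by simp) (by simp), ← add_mul, ENNReal.inv_two_add_inv_two, one_mul]⟩
  exact (hg (2 * p) (ENNReal.mul_ne_top (by simp) hp)).mul
    (hf (2 * p) (ENNReal.mul_ne_top (by simp) hp))

lemma const_mul (hf : FiniteMoments P f) (c : 𝕜) : FiniteMoments P fun ω => c * f ω :=
  fun p hp => (hf p hp).const_mul c

lemma const [IsFiniteMeasure P] (c : 𝕜) : FiniteMoments P fun _ => c :=
  fun _ _ => memLp_const c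

lemma sum {ι : Type*} (s : Finset ι) {F : ι → Ω → 𝕜} (hF : ∀ i ∈ s, FiniteMoments P (F i)) :
    FiniteMoments P fun ω => ∑ i ∈ s, F i ω :=
  fun p hp => memLp_finsetSum s fun i hi => hF i hi p hp

lemma star (hf : FiniteMoments P f) : FiniteMoments P fun ω => star (f ω) :=
  fun p hp => (hf p hp).star

lemma pow [IsFiniteMeasure P] (hf : FiniteMoments P f) (n : ℕ) :
    FiniteMoments P fun ω => f ω ^ n := by
  induction n with
  | zero => simpa using FiniteMoments.const 1
  | succ n ih => simpa only [pow_succ] using ih.mul hf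

lemma ofReal {f : Ω → ℝ} (hf : FiniteMoments P f) : FiniteMoments P fun ω => (f ω : ℂ) :=
  fun p hp => (hf p hp).ofReal

end FiniteMoments

/-! ### Third and fourth moments of a centred real Gaussian -/

section RealMoments

/-- Stated as an identity of functions so that it can be evaluated at `0` for the third moment and
differentiated once more for the fourth. The term `0 * t` is the mean in the Gaussian moment
generating function. -/
lemma iteratedDeriv_three_exp_mul_sq (v : ℝ) :
    iteratedDeriv 3 (fun t : ℝ => Real.exp (0 * t + v * t ^ 2 / 2)) =
      fun t => (3 * v ^ 2 * t + v ^ 3 * t ^ 3) * Real.exp (0 * t + v * t ^ 2 / 2) := by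
  have e : ∀ t : ℝ, HasDerivAt (fun t : ℝ => Real.exp (0 * t + v * t ^ 2 / 2))
      (v * t * Real.exp (0 * t + v * t ^ 2 / 2)) t := by
    intro t
    have h : HasDerivAt (fun t : ℝ => 0 * t + v * t ^ 2 / 2) (v * t) t :=
      (((hasDerivAt_id t).const_mul (0 : ℝ)).add
        ((((hasDerivAt_id t).pow 2).const_mul v).div_const 2)).congr_deriv (by simp; ring)
    exact h.exp.congr_deriv (by ring)
  have h1 : deriv (fun t : ℝ => Real.exp (0 * t + v * t ^ 2 / 2)) =
      fun t => v * t * Real.exp (0 * t + v * t ^ 2 / 2) := funext fun t => (e t).deriv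
  have h2 : deriv (fun t : ℝ => v * t * Real.exp (0 * t + v * t ^ 2 / 2)) =
      fun t => (v + v ^ 2 * t ^ 2) * Real.exp (0 * t + v * t ^ 2 / 2) := funext fun t =>
    ((((hasDerivAt_id t).const_mul v).mul (e t)).congr_deriv (by simp; ring)).deriv
  have h3 : deriv (fun t : ℝ => (v + v ^ 2 * t ^ 2) * Real.exp (0 * t + v * t ^ 2 / 2)) =
      fun t => (3 * v ^ 2 * t + v ^ 3 * t ^ 3) * Real.exp (0 * t + v * t ^ 2 / 2) :=
    funext fun t => ((((((hasDerivAt_id t).pow 2).const_mul (v ^ 2)).const_add v).mul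
      (e t)).congr_deriv (by simp; ring)).deriv
  rw [iteratedDeriv_succ, iteratedDeriv_succ, iteratedDeriv_one, h1, h2, h3]

lemma integral_pow_three_gaussianReal (v : NNReal) : ∫ x, x ^ 3 ∂gaussianReal 0 v = 0 := by
  have h := iteratedDeriv_mgf_zero (X := fun x : ℝ => x) (μ := gaussianReal 0 v) (by simp) 3
  simp only [Pi.pow_apply] at h
  rw [← h, mgf_fun_id_gaussianReal, iteratedDeriv_three_exp_mul_sq]
  simp

lemma integral_pow_four_gaussianReal (v : NNReal) :
    ∫ x, x ^ 4 ∂gaussianReal 0 v = 3 * (v : ℝ) ^ 2 := by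
  have h := iteratedDeriv_mgf_zero (X := fun x : ℝ => x) (μ := gaussianReal 0 v) (by simp) 4
  simp only [Pi.pow_apply] at h
  rw [← h, mgf_fun_id_gaussianReal, iteratedDeriv_succ, iteratedDeriv_three_exp_mul_sq]
  have h1 : HasDerivAt (fun t : ℝ => 3 * (v : ℝ) ^ 2 * t + (v : ℝ) ^ 3 * t ^ 3)
      (3 * (v : ℝ) ^ 2) 0 :=
    (((hasDerivAt_id (0 : ℝ)).const_mul (3 * (v : ℝ) ^ 2)).add
      (((hasDerivAt_id (0 : ℝ)).pow 3).const_mul ((v : ℝ) ^ 3))).congr_deriv (by simp)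
  have h2 : DifferentiableAt ℝ (fun t : ℝ => Real.exp (0 * t + v * t ^ 2 / 2)) 0 := by fun_prop
  -- The polynomial factor vanishes at `0`, so the derivative of the exponential does not
  -- contribute.
  exact ((h1.mul h2.hasDerivAt).congr_deriv (by simp)).deriv

end RealMoments

/-! ### Complex-valued real-linear functionals of a random vector -/

section Functionals

variable {Ω E : Type*} [NormedAddCommGroup E] [NormedSpace ℝ E] {Y : Ω → E}

/-- `f` is a complex-valued real-linear functional of the random vector `Y`. -/
def IsFunctionalOf (Y : Ω → E) (f : Ω → ℂ) : Prop := ∃ L : E →L[ℝ] ℂ, ∀ ω, f ω = L (Y ω)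

namespace IsFunctionalOf

variable {f g : Ω → ℂ}

lemma add (hf : IsFunctionalOf Y f) (hg : IsFunctionalOf Y g) :
    IsFunctionalOf Y fun ω => f ω + g ω := by
  obtain ⟨L, hL⟩ := hf
  obtain ⟨L', hL'⟩ := hg
  exact ⟨L + L', fun ω => by simp [hL, hL']⟩

lemma const_mul (hf : IsFunctionalOf Y f) (c : ℂ) : IsFunctionalOf Y fun ω => c * f ω := by
  obtain ⟨L, hL⟩ := hf
  exact ⟨c • L, fun ω => by simp [hL]⟩

lemma sum {ι : Type*} (s : Finset ι) {F : ι → Ω → ℂ} (hF : ∀ i ∈ s, IsFunctionalOf Y (F i)) :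
    IsFunctionalOf Y fun ω => ∑ i ∈ s, F i ω := by
  classical
  induction s using Finset.induction_on with
  | empty => exact ⟨0, fun ω => by simp⟩
  | insert i s hi ih =>
    simp_rw [Finset.sum_insert hi]
    exact (hF i (by simp)).add (ih fun j hj => hF j (by simp [hj]))

lemma star (hf : IsFunctionalOf Y f) : IsFunctionalOf Y fun ω => star (f ω) := by
  obtain ⟨L, hL⟩ := hf
  exact ⟨Complex.conjCLE.toContinuousLinearMap.comp L, fun ω => by simp [hL]⟩

/-- Reduces moment identities, which are multilinear over `ℂ`, to real functionals. Linearity is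
only over `ℝ` because conjugates must be allowed. -/
lemma re_add_im (hf : IsFunctionalOf Y f) : ∃ L L' : E →L[ℝ] ℝ,
    f = fun ω => (L (Y ω) : ℂ) + Complex.I * (L' (Y ω) : ℂ) := by
  obtain ⟨L, hL⟩ := hf
  refine ⟨Complex.reCLM.comp L, Complex.imCLM.comp L, funext fun ω => ?_⟩
  rw [hL, mul_comm]
  exact (Complex.re_add_im _).symm

end IsFunctionalOf

end Functionals

/-! ### Isserlis' theorem, real and complex, centred and with means -/

section Wick

variable {Ω E : Type*} [MeasurableSpace Ω] {P : Measure Ω} [NormedAddCommGroup E]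
  [NormedSpace ℝ E] [MeasurableSpace E] [BorelSpace E] {Y : Ω → E}

/-- A real functional of a centred Gaussian vector is a centred real Gaussian, so the
one-dimensional moments apply. -/
lemma integral_pow_three_and_four (hY : HasGaussianLaw Y P)
    (h0 : ∀ L : E →L[ℝ] ℝ, ∫ ω, L (Y ω) ∂P = 0) (L : E →L[ℝ] ℝ) :
    ∫ ω, L (Y ω) ^ 3 ∂P = 0 ∧ ∫ ω, L (Y ω) ^ 4 ∂P = 3 * (∫ ω, L (Y ω) ^ 2 ∂P) ^ 2 := by
  have hL := hY.map_fun L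
  have hlaw := hL.map_eq_gaussianReal
  rw [h0 L] at hlaw
  have hvar : ((Var[fun ω => L (Y ω); P]).toNNReal : ℝ) = ∫ ω, L (Y ω) ^ 2 ∂P := by
    rw [Real.coe_toNNReal _ (variance_nonneg _ _),
      variance_of_integral_eq_zero hL.aemeasurable (h0 L)]
  have hpow : ∀ n : ℕ, ∫ ω, L (Y ω) ^ n ∂P =
      ∫ x, x ^ n ∂gaussianReal 0 (Var[fun ω => L (Y ω); P]).toNNReal := fun n => by
    rw [← hlaw, integral_map hL.aemeasurable (by fun_prop)]
  rw [hpow 3, hpow 4, integral_pow_three_gaussianReal, integral_pow_four_gaussianReal, hvar]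
  exact ⟨rfl, rfl⟩

lemma finiteMoments_real (hY : HasGaussianLaw Y P) (L : E →L[ℝ] ℝ) :
    FiniteMoments P fun ω => L (Y ω) := fun _ hp => (hY.map_fun L).memLp hp

lemma IsFunctionalOf.finiteMoments {f : Ω → ℂ} (hf : IsFunctionalOf Y f) (hY : HasGaussianLaw Y P) : FiniteMoments P f := by
  obtain ⟨L, L', rfl⟩ := hf.re_add_im
  exact (finiteMoments_real hY L).ofReal.add ((finiteMoments_real hY L').ofReal.const_mul _)

lemma IsFunctionalOf.integral_eq_zero {f : Ω → ℂ} (hf : IsFunctionalOf Y f) (hY : HasGaussianLaw Y P)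
    (h0 : ∀ L : E →L[ℝ] ℝ, ∫ ω, L (Y ω) ∂P = 0) : ∫ ω, f ω ∂P = 0 := by
  obtain ⟨L, L', rfl⟩ := hf.re_add_im
  rw [integral_add (finiteMoments_real hY L).ofReal.integrable
    ((finiteMoments_real hY L').ofReal.const_mul _).integrable, integral_const_mul,
    integral_complex_ofReal, integral_complex_ofReal, h0, h0]
  simp

variable [IsProbabilityMeasure P]

/-- Polarization expresses a product of three functionals through cubes of signed sums, each of mean
zero. -/
lemma integral_mul_three_real (hY : HasGaussianLaw Y P)
    (h0 : ∀ L : E →L[ℝ] ℝ, ∫ ω, L (Y ω) ∂P = 0) (L₁ L₂ L₃ : E →L[ℝ] ℝ) :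
    ∫ ω, L₁ (Y ω) * L₂ (Y ω) * L₃ (Y ω) ∂P = 0 := by
  have hi : ∀ L : E →L[ℝ] ℝ, FiniteMoments P fun ω => L (Y ω) ^ 3 :=
    fun L => (finiteMoments_real hY L).pow 3
  have h3 := fun L => (integral_pow_three_and_four hY h0 L).1
  have hpol : ∀ ω, L₁ (Y ω) * L₂ (Y ω) * L₃ (Y ω) =
      (1 / 24) * ((((L₁ + L₂ + L₃) (Y ω) ^ 3 - (L₁ + L₂ - L₃) (Y ω) ^ 3)
        - (L₁ - L₂ + L₃) (Y ω) ^ 3) + (L₁ - L₂ - L₃) (Y ω) ^ 3) := fun ω => by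
    simp only [_root_.add_apply, _root_.sub_apply]
    ring
  simp_rw [hpol]
  rw [integral_const_mul, integral_add (((hi _).sub (hi _)).sub (hi _)).integrable (hi _).integrable,
    integral_sub ((hi _).sub (hi _)).integrable (hi _).integrable, integral_sub (hi _).integrable (hi _).integrable]
  simp only [h3, sub_zero, add_zero, mul_zero]

lemma integral_mul_four_real (hY : HasGaussianLaw Y P)
    (h0 : ∀ L : E →L[ℝ] ℝ, ∫ ω, L (Y ω) ∂P = 0) (L₁ L₂ L₃ L₄ : E →L[ℝ] ℝ) :
    ∫ ω, L₁ (Y ω) * L₂ (Y ω) * L₃ (Y ω) * L₄ (Y ω) ∂P =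
      (∫ ω, L₁ (Y ω) * L₂ (Y ω) ∂P) * (∫ ω, L₃ (Y ω) * L₄ (Y ω) ∂P)
      + (∫ ω, L₁ (Y ω) * L₃ (Y ω) ∂P) * (∫ ω, L₂ (Y ω) * L₄ (Y ω) ∂P)
      + (∫ ω, L₁ (Y ω) * L₄ (Y ω) ∂P) * (∫ ω, L₂ (Y ω) * L₃ (Y ω) ∂P) := by
  have hm := finiteMoments_real hY
  have hi : ∀ L : E →L[ℝ] ℝ, FiniteMoments P fun ω => L (Y ω) ^ 4 :=
    fun L => (hm L).pow 4
  -- The covariance as an opaque symmetric bilinear form: after polarization the claim is a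
  -- polynomial identity in its values.
  obtain ⟨C, hC⟩ : ∃ C : (E →L[ℝ] ℝ) → (E →L[ℝ] ℝ) → ℝ,
    ∀ L L', ∫ ω, L (Y ω) * L' (Y ω) ∂P = C L L' := ⟨_, fun _ _ => rfl⟩
  have hsymm : ∀ L L', C L L' = C L' L := fun L L' => by simp_rw [← hC, mul_comm]
  have hadd : ∀ L L' L'', C (L + L') L'' = C L L'' + C L' L'' := fun L L' L'' => by
    simp_rw [← hC, _root_.add_apply, add_mul]
    exact integral_add ((hm L).mul (hm L'')).integrable ((hm L').mul (hm L'')).integrable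
  have hsub : ∀ L L' L'', C (L - L') L'' = C L L'' - C L' L'' := fun L L' L'' => by
    simp_rw [← hC, _root_.sub_apply, sub_mul]
    exact integral_sub ((hm L).mul (hm L'')).integrable ((hm L').mul (hm L'')).integrable
  have hadd' : ∀ L L' L'', C L'' (L + L') = C L'' L + C L'' L' := fun L L' L'' => by
    rw [hsymm, hadd, hsymm L, hsymm L']
  have hsub' : ∀ L L' L'', C L'' (L - L') = C L'' L - C L'' L' := fun L L' L'' => by
    rw [hsymm, hsub, hsymm L, hsymm L']
  have h4 : ∀ L : E →L[ℝ] ℝ, ∫ ω, L (Y ω) ^ 4 ∂P = 3 * C L L ^ 2 := fun L => by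
    rw [(integral_pow_three_and_four hY h0 L).2, ← hC]
    simp_rw [sq]
  -- Polarization over the `8` sign choices for the last three functionals; each contributes `4! =
  -- 24` times the product, hence `192`.
  have hpol : ∀ ω, L₁ (Y ω) * L₂ (Y ω) * L₃ (Y ω) * L₄ (Y ω) =
      (1 / 192) * ((((((((L₁ + L₂ + L₃ + L₄) (Y ω) ^ 4 - (L₁ + L₂ + L₃ - L₄) (Y ω) ^ 4)
        - (L₁ + L₂ - L₃ + L₄) (Y ω) ^ 4) - (L₁ - L₂ + L₃ + L₄) (Y ω) ^ 4)
        + (L₁ + L₂ - L₃ - L₄) (Y ω) ^ 4) + (L₁ - L₂ + L₃ - L₄) (Y ω) ^ 4)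
        + (L₁ - L₂ - L₃ + L₄) (Y ω) ^ 4) - (L₁ - L₂ - L₃ - L₄) (Y ω) ^ 4) := fun ω => by
    simp only [_root_.add_apply, _root_.sub_apply]
    ring
  simp_rw [hpol]
  have i1 := (hi (L₁ + L₂ + L₃ + L₄)).sub (hi (L₁ + L₂ + L₃ - L₄))
  have i2 := i1.sub (hi (L₁ + L₂ - L₃ + L₄))
  have i3 := i2.sub (hi (L₁ - L₂ + L₃ + L₄))
  have i4 := i3.add (hi (L₁ + L₂ - L₃ - L₄))
  have i5 := i4.add (hi (L₁ - L₂ + L₃ - L₄))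
  have i6 := i5.add (hi (L₁ - L₂ - L₃ + L₄))
  rw [integral_const_mul, integral_sub i6.integrable (hi _).integrable, integral_add i5.integrable (hi _).integrable,
    integral_add i4.integrable (hi _).integrable, integral_add i3.integrable (hi _).integrable, integral_sub i2.integrable (hi _).integrable,
    integral_sub i1.integrable (hi _).integrable, integral_sub (hi _).integrable (hi _).integrable]
  simp only [h4, hC, hadd, hsub, hadd', hsub']
  rw [hsymm L₂ L₁, hsymm L₃ L₁, hsymm L₄ L₁, hsymm L₃ L₂, hsymm L₄ L₂, hsymm L₄ L₃]
  ring

namespace IsFunctionalOf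

variable {f g h k : Ω → ℂ}

/-- Products of three centred jointly Gaussian variables have mean zero. -/
lemma integral_mul_three (hf : IsFunctionalOf Y f) (hg : IsFunctionalOf Y g)
    (hh : IsFunctionalOf Y h) (hY : HasGaussianLaw Y P)
    (h0 : ∀ L : E →L[ℝ] ℝ, ∫ ω, L (Y ω) ∂P = 0) : ∫ ω, f ω * g ω * h ω ∂P = 0 := by
  -- The last factor is split into real functionals, which move to the front. Three such rotations
  -- make every factor real.
  have step : ∀ u v : Ω → ℂ, FiniteMoments P u → FiniteMoments P v →
      (∀ L : E →L[ℝ] ℝ, ∫ ω, (L (Y ω) : ℂ) * u ω * v ω ∂P = 0) →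
      ∀ {f}, IsFunctionalOf Y f → ∫ ω, u ω * v ω * f ω ∂P = 0 := by
    intro u v hu hv H f hf
    obtain ⟨L, L', rfl⟩ := hf.re_add_im
    have i : ∀ L : E →L[ℝ] ℝ, Integrable (fun ω => (L (Y ω) : ℂ) * u ω * v ω) P := fun L =>
      (((finiteMoments_real hY L).ofReal.mul hu).mul hv).integrable
    calc _ = ∫ ω, ((L (Y ω) : ℂ) * u ω * v ω + Complex.I * ((L' (Y ω) : ℂ) * u ω * v ω)) ∂P := by
          congr with ω; ring
      _ = 0 := by
        rw [integral_add (i L) ((i L').const_mul _), integral_const_mul, H, H]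
        simp
  have hr := fun L => (finiteMoments_real hY L).ofReal
  have hfm := hf.finiteMoments hY
  have hgm := hg.finiteMoments hY
  refine step _ _ hfm hgm (fun L₃ => ?_) hh
  refine step _ _ (hr L₃) hfm (fun L₂ => ?_) hg
  refine step _ _ (hr L₂) (hr L₃) (fun L₁ => ?_) hf
  have := integral_mul_three_real hY h0 L₁ L₂ L₃
  exact_mod_cast congrArg (fun x : ℝ => (x : ℂ)) this

/-- **Isserlis' theorem** for four centred jointly Gaussian variables. -/
lemma integral_mul_four (hf : IsFunctionalOf Y f) (hg : IsFunctionalOf Y g)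
    (hh : IsFunctionalOf Y h) (hk : IsFunctionalOf Y k) (hY : HasGaussianLaw Y P)
    (h0 : ∀ L : E →L[ℝ] ℝ, ∫ ω, L (Y ω) ∂P = 0) :
    ∫ ω, f ω * g ω * h ω * k ω ∂P =
      (∫ ω, f ω * g ω ∂P) * (∫ ω, h ω * k ω ∂P) + (∫ ω, f ω * h ω ∂P) * (∫ ω, g ω * k ω ∂P)
      + (∫ ω, f ω * k ω ∂P) * (∫ ω, g ω * h ω ∂P) := by
  let W (f g h k : Ω → ℂ) : Prop := ∫ ω, f ω * g ω * h ω * k ω ∂P =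
    (∫ ω, f ω * g ω ∂P) * (∫ ω, h ω * k ω ∂P) + (∫ ω, f ω * h ω ∂P) * (∫ ω, g ω * k ω ∂P)
    + (∫ ω, f ω * k ω ∂P) * (∫ ω, g ω * h ω ∂P)
  -- The same rotation argument; the sum over pairings is symmetric, so it is compatible with
  -- rotating the factors.
  have step : ∀ u v w : Ω → ℂ, FiniteMoments P u → FiniteMoments P v → FiniteMoments P w →
      (∀ L : E →L[ℝ] ℝ, W (fun ω => (L (Y ω) : ℂ)) u v w) →
      ∀ {f}, IsFunctionalOf Y f → W u v w f := by
    intro u v w hu hv hw H f hf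
    obtain ⟨L, L', rfl⟩ := hf.re_add_im
    have hr := fun L => (finiteMoments_real hY L).ofReal
    have i4 := fun L => ((((hr L).mul hu).mul hv).mul hw).integrable
    have i2 : ∀ u, FiniteMoments P u → ∫ ω, u ω * ((L (Y ω) : ℂ) + Complex.I * (L' (Y ω) : ℂ)) ∂P =
        ∫ ω, (L (Y ω) : ℂ) * u ω ∂P + Complex.I * ∫ ω, (L' (Y ω) : ℂ) * u ω ∂P := by
      intro u hu
      rw [← integral_const_mul, ← integral_add ((hr L).mul hu).integrable
        (((hr L').mul hu).integrable.const_mul _)]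
      congr with ω; ring
    have e4 : ∫ ω, u ω * v ω * w ω * ((L (Y ω) : ℂ) + Complex.I * (L' (Y ω) : ℂ)) ∂P =
        ∫ ω, (L (Y ω) : ℂ) * u ω * v ω * w ω ∂P
          + Complex.I * ∫ ω, (L' (Y ω) : ℂ) * u ω * v ω * w ω ∂P := by
      rw [← integral_const_mul, ← integral_add (i4 L) ((i4 L').const_mul _)]
      congr with ω; ring
    have H1 := H L
    have H2 := H L'
    simp only [W] at H1 H2 ⊢
    rw [e4, i2 _ hu, i2 _ hv, i2 _ hw, H1, H2]
    ring
  have hr := fun L => (finiteMoments_real hY L).ofReal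
  have hfm := hf.finiteMoments hY
  have hgm := hg.finiteMoments hY
  have hhm := hh.finiteMoments hY
  change W f g h k
  refine step _ _ _ hfm hgm hhm (fun L₄ => ?_) hk
  refine step _ _ _ (hr L₄) hfm hgm (fun L₃ => ?_) hh
  refine step _ _ _ (hr L₃) (hr L₄) hfm (fun L₂ => ?_) hg
  refine step _ _ _ (hr L₂) (hr L₃) (hr L₄) (fun L₁ => ?_) hf
  have := congrArg (fun x : ℝ => (x : ℂ)) (integral_mul_four_real hY h0 L₁ L₂ L₃ L₄)
  simp only [W]
  exact_mod_cast this

lemma integral_const_add_mul_two (hf : IsFunctionalOf Y f) (hg : IsFunctionalOf Y g)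
    (hY : HasGaussianLaw Y P) (h0 : ∀ L : E →L[ℝ] ℝ, ∫ ω, L (Y ω) ∂P = 0) (a b : ℂ) :
    ∫ ω, (a + f ω) * (b + g ω) ∂P = a * b + ∫ ω, f ω * g ω ∂P := by
  have hfm := hf.finiteMoments hY
  have hgm := hg.finiteMoments hY
  calc _ = ∫ ω, (a * b + (a * g ω + (b * f ω + f ω * g ω))) ∂P := by congr with ω; ring
    _ = _ := by
      rw [integral_add (integrable_const _) ((hgm.const_mul a).add ((hfm.const_mul b).add
          (hfm.mul hgm))).integrable, integral_add (hgm.const_mul a).integrable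
          ((hfm.const_mul b).add (hfm.mul hgm)).integrable,
        integral_add (hfm.const_mul b).integrable (hfm.mul hgm).integrable]
      simp [integral_const_mul, hf.integral_eq_zero hY h0, hg.integral_eq_zero hY h0]

/-- The fourth mixed moment of jointly Gaussian variables with means `a`, `b`, `c`, `d`, in terms
of the second mixed moments. -/
lemma integral_const_add_mul_four (hf : IsFunctionalOf Y f) (hg : IsFunctionalOf Y g)
    (hh : IsFunctionalOf Y h) (hk : IsFunctionalOf Y k) (hY : HasGaussianLaw Y P)
    (h0 : ∀ L : E →L[ℝ] ℝ, ∫ ω, L (Y ω) ∂P = 0) (a b c d : ℂ) :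
    ∫ ω, (a + f ω) * (b + g ω) * (c + h ω) * (d + k ω) ∂P =
      (∫ ω, (a + f ω) * (b + g ω) ∂P) * (∫ ω, (c + h ω) * (d + k ω) ∂P)
      + (∫ ω, (a + f ω) * (c + h ω) ∂P) * (∫ ω, (b + g ω) * (d + k ω) ∂P)
      + (∫ ω, (a + f ω) * (d + k ω) ∂P) * (∫ ω, (b + g ω) * (c + h ω) ∂P)
      - 2 * (a * b * c * d) := by
  have hfm := hf.finiteMoments hY
  have hgm := hg.finiteMoments hY
  have hhm := hh.finiteMoments hY
  have hkm := hk.finiteMoments hY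
  have peel : ∀ (u v : Ω → ℂ) (t : ℂ), FiniteMoments P u → FiniteMoments P v →
      ∫ ω, u ω * (t + v ω) ∂P = t * ∫ ω, u ω ∂P + ∫ ω, u ω * v ω ∂P := by
    intro u v t hu hv
    rw [← integral_const_mul, ← integral_add (hu.const_mul t).integrable (hu.mul hv).integrable]
    congr with ω; ring
  have shift : ∀ {u} (t : ℂ), FiniteMoments P u → FiniteMoments P fun ω => t + u ω :=
    fun t hu => (FiniteMoments.const t).add hu
  -- Terms with one or three fluctuations have mean zero, which leaves the constant and the terms
  -- with two.
  have three : ∀ {u v w : Ω → ℂ} (r s t : ℂ), IsFunctionalOf Y u → IsFunctionalOf Y v →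
      IsFunctionalOf Y w → ∫ ω, (r + u ω) * (s + v ω) * (t + w ω) ∂P =
        r * s * t + r * ∫ ω, v ω * w ω ∂P + s * ∫ ω, u ω * w ω ∂P + t * ∫ ω, u ω * v ω ∂P := by
    intro u v w r s t hu hv hw
    have hum := hu.finiteMoments hY
    have hvm := hv.finiteMoments hY
    have hwm := hw.finiteMoments hY
    rw [peel _ _ _ ((shift r hum).mul (shift s hvm)) hwm,
      hu.integral_const_add_mul_two hv hY h0]
    have : ∫ ω, (r + u ω) * (s + v ω) * w ω ∂P = ∫ ω, (u ω * w ω) * (s + v ω) ∂P +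
        r * ∫ ω, w ω * (s + v ω) ∂P := by
      rw [← integral_const_mul, ← integral_add ((hum.mul hwm).mul (shift s hvm)).integrable
        ((hwm.mul (shift s hvm)).const_mul r).integrable]
      congr with ω; ring
    rw [this, peel _ _ _ (hum.mul hwm) hvm, peel _ _ _ hwm hvm,
      hu.integral_mul_three hw hv hY h0, hw.integral_eq_zero hY h0]
    simp_rw [mul_comm (w _)]
    ring
  have t1 := three b c d hg hh hk
  have t2 := peel _ _ a (((shift b hgm).mul (shift c hhm)).mul (shift d hkm)) hfm
  have t3 : ∫ ω, (b + g ω) * (c + h ω) * (d + k ω) * f ω ∂P =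
      b * (c * ∫ ω, f ω * k ω ∂P + d * ∫ ω, f ω * h ω ∂P) + c * d * ∫ ω, f ω * g ω ∂P
        + ∫ ω, f ω * g ω * h ω * k ω ∂P := by
    have e1 : ∀ {u}, IsFunctionalOf Y u → ∀ t s : ℂ, ∀ {v}, IsFunctionalOf Y v →
        ∫ ω, f ω * (s + u ω) * (t + v ω) ∂P = t * ∫ ω, f ω * u ω ∂P + s * ∫ ω, f ω * v ω ∂P := by
      intro u hu t s v hv
      have := three 0 s t hf hu hv
      simp only [zero_add, zero_mul] at this
      rw [this]
      ring
    have e2 : ∫ ω, (f ω * g ω) * (c + h ω) * (d + k ω) ∂P =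
        c * d * ∫ ω, f ω * g ω ∂P + ∫ ω, f ω * g ω * h ω * k ω ∂P := by
      rw [peel _ _ _ ((hfm.mul hgm).mul (shift c hhm)) hkm, peel _ _ _ (hfm.mul hgm) hhm,
        hf.integral_mul_three hg hh hY h0]
      have : ∫ ω, f ω * g ω * (c + h ω) * k ω ∂P = ∫ ω, f ω * g ω * k ω * (c + h ω) ∂P := by
        congr with ω; ring
      rw [this, peel _ _ _ ((hfm.mul hgm).mul hkm) hhm, hf.integral_mul_three hg hk hY h0]
      have : ∫ ω, f ω * g ω * k ω * h ω ∂P = ∫ ω, f ω * g ω * h ω * k ω ∂P := by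
        congr with ω; ring
      rw [this]
      ring
    have : ∫ ω, (b + g ω) * (c + h ω) * (d + k ω) * f ω ∂P =
        b * ∫ ω, f ω * (c + h ω) * (d + k ω) ∂P + ∫ ω, (f ω * g ω) * (c + h ω) * (d + k ω) ∂P := by
      rw [← integral_const_mul, ← integral_add
        (((hfm.mul (shift c hhm)).mul (shift d hkm)).const_mul b).integrable
        (((hfm.mul hgm).mul (shift c hhm)).mul (shift d hkm)).integrable]
      congr with ω; ring
    rw [this, e1 hh d c hk, e2]
    ring
  have t0 : ∫ ω, (a + f ω) * (b + g ω) * (c + h ω) * (d + k ω) ∂P =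
      ∫ ω, (b + g ω) * (c + h ω) * (d + k ω) * (a + f ω) ∂P := by
    congr with ω; ring
  -- Each of the three pairings contains the product of means once, the fourth moment also contains
  -- it once: hence the correction `-2`.
  rw [t0, t2, t1, t3, hf.integral_mul_four hg hh hk hY h0,
    hf.integral_const_add_mul_two hg hY h0, hh.integral_const_add_mul_two hk hY h0,
    hf.integral_const_add_mul_two hh hY h0, hg.integral_const_add_mul_two hk hY h0,
    hf.integral_const_add_mul_two hk hY h0, hg.integral_const_add_mul_two hh hY h0]
  ring

end IsFunctionalOf

end Wick
lemma integral_sum_const_mul_mul {Ω ι : Type*} [MeasurableSpace Ω] {P : Measure Ω} (s : Finset ι)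
    (c : ι → ℂ) {F : ι → Ω → ℂ} {f : Ω → ℂ} (hF : ∀ i ∈ s, FiniteMoments P (F i))
    (hf : FiniteMoments P f) :
    ∫ ω, (∑ i ∈ s, c i * F i ω) * f ω ∂P = ∑ i ∈ s, c i * ∫ ω, F i ω * f ω ∂P := by
  simp_rw [Finset.sum_mul, mul_assoc]
  rw [integral_finsetSum s fun i hi => (((hF i hi).mul hf).const_mul (c i)).integrable]
  simp_rw [integral_const_mul]

lemma integral_mul_star_comm {Ω : Type*} [MeasurableSpace Ω] {P : Measure Ω} (f g : Ω → ℂ) :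
    ∫ ω, f ω * star (g ω) ∂P = star (∫ ω, g ω * star (f ω) ∂P) := by
  refine Eq.trans ?_ (integral_conj (f := fun ω => g ω * star (f ω)) (μ := P))
  congr with ω
  simp [mul_comm]

/-! ### Channels and estimates as constants plus functionals of one Gaussian vector -/

variable {Ω : Type*} {M K N τp : ℕ}

namespace Randomness

/-- The random vectors on which the signals of user `k` depend: all the NLoS components, and the
pilot noises for user `k`. -/
def components (X : Randomness Ω M K N) (k : Fin K) :
    (Fin M × Fin K) ⊕ Fin M → Ω → Fin N → ℂ :=
  Sum.elim (fun i => X.nlos i.1 i.2) (fun m => X.noise m k)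

lemma components_inl (X : Randomness Ω M K N) (k : Fin K) (i : Fin M × Fin K) :
    X.components k (Sum.inl i) = X.nlos i.1 i.2 := rfl

end Randomness

namespace Network

variable (S : Network M K N τp) (X : Randomness Ω M K N)

/-- Covariance matrices of `Randomness.components`. -/
def componentCov : (Fin M × Fin K) ⊕ Fin M → Matrix (Fin N) (Fin N) ℂ :=
  Sum.elim (fun i => S.R i.1 i.2)
    fun _ => ((τp * S.σ ^ 2 : ℝ) : ℂ) • (1 : Matrix (Fin N) (Fin N) ℂ)

/-- The random part of the despread pilot signal. -/
noncomputable def pilotFluct (k : Fin K) (m : Fin M) (i : Fin N) (ω : Ω) : ℂ :=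
  ∑ l ∈ S.copilot k, S.amp l * X.nlos m l ω i + X.noise m k ω i

/-- The random part of the channel estimate. -/
noncomputable def estFluct (k : Fin K) (m : Fin M) (i : Fin N) (ω : Ω) : ℂ :=
  ∑ j, S.A m k i j * S.pilotFluct X k m j ω

lemma g_apply (m : Fin M) (l : Fin K) (ω : Ω) (i : Fin N) :
    S.g X m l ω i = S.los m l i + X.nlos m l ω i := rfl

lemma ghat_apply (m : Fin M) (k : Fin K) (ω : Ω) (i : Fin N) :
    S.ghat X m k ω i = S.los m k i + S.estFluct X k m i ω := by
  have h : S.pilotSignal X m k ω - S.pilotMean m k = fun j => S.pilotFluct X k m j ω := by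
    ext j
    simp only [pilotSignal, pilotMean, pilotFluct, g_apply, mul_add, Finset.sum_add_distrib,
      Pi.sub_apply, Pi.add_apply, Finset.sum_apply, Pi.smul_apply, smul_eq_mul]
    ring
  simp [ghat, h, estFluct, mulVec, dotProduct]

lemma star_amp (l : Fin K) : star (S.amp l) = S.amp l := Complex.conj_ofReal _

lemma amp_mul_amp (l : Fin K) : S.amp l * S.amp l = ((S.p l * τp ^ 2 : ℝ) : ℂ) := by
  rw [amp, ← Complex.ofReal_mul]
  congr 1
  have := Real.mul_self_sqrt (S.p_nonneg l)
  linear_combination (τp : ℝ) ^ 2 * this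

lemma q_apply (k l : Fin K) (ω : Ω) (i j : Fin N) (m : Fin M) :
    S.q X k l ω ((j, i), m) = S.g X m l ω i * star (S.ghat X m k ω j) := rfl

end Network

section Functionals

variable {S : Network M K N τp} {X : Randomness Ω M K N}

lemma isFunctionalOf_component (k : Fin K) (j : (Fin M × Fin K) ⊕ Fin M) (i : Fin N) :
    IsFunctionalOf (fun ω j => X.components k j ω) fun ω => X.components k j ω i :=
  ⟨(ContinuousLinearMap.proj i).comp (ContinuousLinearMap.proj (R := ℝ)
    (φ := fun _ : (Fin M × Fin K) ⊕ Fin M => Fin N → ℂ) j), fun _ => rfl⟩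

lemma isFunctionalOf_nlos (k : Fin K) (m : Fin M) (l : Fin K) (i : Fin N) :
    IsFunctionalOf (fun ω j => X.components k j ω) fun ω => X.nlos m l ω i :=
  isFunctionalOf_component k (Sum.inl (m, l)) i

lemma isFunctionalOf_pilotFluct (k : Fin K) (m : Fin M) (i : Fin N) :
    IsFunctionalOf (fun ω j => X.components k j ω) (S.pilotFluct X k m i) :=
  (IsFunctionalOf.sum _ fun l _ => (isFunctionalOf_nlos k m l i).const_mul (S.amp l)).add
    (isFunctionalOf_component k (Sum.inr m) i)

lemma isFunctionalOf_estFluct (k : Fin K) (m : Fin M) (i : Fin N) :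
    IsFunctionalOf (fun ω j => X.components k j ω) (S.estFluct X k m i) :=
  IsFunctionalOf.sum _ fun j _ => (isFunctionalOf_pilotFluct k m j).const_mul (S.A m k i j)

end Functionals

namespace IsModel

variable [MeasurableSpace Ω] {P : Measure Ω} {S : Network M K N τp} {X : Randomness Ω M K N}

lemma isComplexGaussian (hX : IsModel P S X) (k : Fin K) (j : (Fin M × Fin K) ⊕ Fin M) :
    IsComplexGaussian P (X.components k j) (S.componentCov j) := by
  rcases j with ⟨m, l⟩ | m
  · exact hX.nlos m l
  · exact hX.noise m k

lemma iIndepFun_components (hX : IsModel P S X) (k : Fin K) : iIndepFun (X.components k) P :=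
  hX.indep k

/-- Independent Gaussian vectors are jointly Gaussian. The user `k` is fixed because noises formed
for different users need not be independent. -/
lemma hasGaussianLaw (hX : IsModel P S X) (k : Fin K) :
    HasGaussianLaw (fun ω j => X.components k j ω) P :=
  (hX.iIndepFun_components k).hasGaussianLaw fun j => (hX.isComplexGaussian k j).gaussian

lemma integral_functional (hX : IsModel P S X) (k : Fin K)
    (L : ((Fin M × Fin K) ⊕ Fin M → Fin N → ℂ) →L[ℝ] ℝ) :
    ∫ ω, L (fun j => X.components k j ω) ∂P = 0 := by
  have hi := (hX.hasGaussianLaw k).integrable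
  rw [L.integral_comp_comm hi]
  convert L.map_zero
  ext j i
  have hj : ∀ j, Integrable (fun ω => X.components k j ω) P :=
    fun j => (hX.isComplexGaussian k j).gaussian.integrable
  rw [eval_integral hj, eval_integral fun i => (hj j).eval i]
  exact (hX.isComplexGaussian k j).mean i

/-! ### Covariances and pseudo-covariances of the fluctuations -/

section Covariance

variable (hX : IsModel P S X) (k : Fin K)
include hX

lemma integral_component_mul_star (j j' : (Fin M × Fin K) ⊕ Fin M) (a b : Fin N) :
    ∫ ω, X.components k j ω a * star (X.components k j' ω b) ∂P =
      if j = j' then S.componentCov j a b else 0 := by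
  split_ifs with h
  · subst h
    exact (hX.isComplexGaussian k j).cov a b
  · have hm := fun j => (hX.isComplexGaussian k j).gaussian.aemeasurable
    have := ((hX.iIndepFun_components k).indepFun h).integral_fun_comp_mul_comp (hm j) (hm j')
      (f := fun x : Fin N → ℂ => x a) (g := fun x : Fin N → ℂ => star (x b))
      (measurable_pi_apply a).aestronglyMeasurable (continuous_star.measurable.comp (measurable_pi_apply b)).aestronglyMeasurable
    rw [this, (hX.isComplexGaussian k j).mean, zero_mul]

lemma integral_component_mul (j j' : (Fin M × Fin K) ⊕ Fin M) (a b : Fin N) :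
    ∫ ω, X.components k j ω a * X.components k j' ω b ∂P = 0 := by
  by_cases h : j = j'
  · subst h
    exact (hX.isComplexGaussian k j).pseudoCov a b
  · have hm := fun j => (hX.isComplexGaussian k j).gaussian.aemeasurable
    have := ((hX.iIndepFun_components k).indepFun h).integral_fun_comp_mul_comp (hm j) (hm j')
      (f := fun x : Fin N → ℂ => x a) (g := fun x : Fin N → ℂ => x b)
      (measurable_pi_apply a).aestronglyMeasurable (measurable_pi_apply b).aestronglyMeasurable
    rw [this, (hX.isComplexGaussian k j).mean, zero_mul]

/-- Not an assumption on `Network`: `R` is Hermitian because it is a covariance matrix. -/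
lemma star_R (m : Fin M) (l : Fin K) (a b : Fin N) : star (S.R m l a b) = S.R m l b a := by
  rw [← (hX.nlos m l).cov, ← (hX.nlos m l).cov, ← integral_mul_star_comm]

lemma integral_pilotFluct_mul (m : Fin M) (i : Fin N) {f : Ω → ℂ} (hf : FiniteMoments P f) :
    ∫ ω, S.pilotFluct X k m i ω * f ω ∂P =
      ∑ l ∈ S.copilot k, S.amp l * ∫ ω, X.components k (Sum.inl (m, l)) ω i * f ω ∂P
        + ∫ ω, X.components k (Sum.inr m) ω i * f ω ∂P := by
  have hc := fun j => (isFunctionalOf_component (X := X) k j i).finiteMoments (hX.hasGaussianLaw k)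
  rw [← integral_sum_const_mul_mul _ _ (fun l _ => hc _) hf,
    ← integral_add ((FiniteMoments.sum _ fun l _ => (hc _).const_mul _).mul hf).integrable
      ((hc _).mul hf).integrable]
  simp_rw [← add_mul]
  rfl

lemma integral_pilotFluct_mul_star_nlos (m m' : Fin M) (l : Fin K) (a b : Fin N) :
    ∫ ω, S.pilotFluct X k m a ω * star (X.nlos m' l ω b) ∂P =
      if m = m' ∧ l ∈ S.copilot k then S.amp l * S.R m l a b else 0 := by
  have hf := (isFunctionalOf_nlos (X := X) k m' l b).star.finiteMoments (hX.hasGaussianLaw k)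
  have h := fun j => hX.integral_component_mul_star k j (Sum.inl (m', l)) a b
  have := hX.integral_pilotFluct_mul k m a hf
  simp only [X.components_inl k (m', l) ▸ h] at this
  refine this.trans ?_
  by_cases hm : m = m' <;> simp [hm, Network.componentCov]

lemma integral_pilotFluct_mul_star_noise (m m' : Fin M) (a b : Fin N) :
    ∫ ω, S.pilotFluct X k m a ω * star (X.noise m' k ω b) ∂P =
      if m = m' then ((τp * S.σ ^ 2 : ℝ) : ℂ) * (1 : Matrix (Fin N) (Fin N) ℂ) a b else 0 := by
  have hf := (isFunctionalOf_component (X := X) k (Sum.inr m') b).star.finiteMoments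
    (hX.hasGaussianLaw k)
  have h := fun j => hX.integral_component_mul_star k j (Sum.inr m') a b
  have := hX.integral_pilotFluct_mul k m a hf
  simp only [h] at this
  refine this.trans ?_
  by_cases hm : m = m' <;> simp [hm, Network.componentCov]

lemma integral_pilotFluct_mul_nlos (m m' : Fin M) (l : Fin K) (a b : Fin N) :
    ∫ ω, S.pilotFluct X k m a ω * X.nlos m' l ω b ∂P = 0 := by
  have hf := (isFunctionalOf_nlos (X := X) k m' l b).finiteMoments (hX.hasGaussianLaw k)
  have h := fun j => hX.integral_component_mul k j (Sum.inl (m', l)) a b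
  have := hX.integral_pilotFluct_mul k m a hf
  simp only [X.components_inl k (m', l) ▸ h] at this
  simpa using this

/-- The squared amplitudes `p_l τp²` and the noise variance `τp σ²` share a factor `τp`; what
remains is `Ψ`. -/
lemma integral_pilotFluct_mul_star (m m' : Fin M) (a b : Fin N) :
    ∫ ω, S.pilotFluct X k m a ω * star (S.pilotFluct X k m' b ω) ∂P =
      if m = m' then (τp : ℂ) * S.Psi m k a b else 0 := by
  have hf := (isFunctionalOf_pilotFluct (S := S) (X := X) k m' b).star.finiteMoments
    (hX.hasGaussianLaw k)
  rw [hX.integral_pilotFluct_mul k m a hf]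
  have h1 : ∀ l, ∫ ω, X.components k (Sum.inl (m, l)) ω a * star (S.pilotFluct X k m' b ω) ∂P =
      if m = m' ∧ l ∈ S.copilot k then S.amp l * S.R m l a b else 0 := fun l => by
    rw [integral_mul_star_comm]
    refine (congrArg star (hX.integral_pilotFluct_mul_star_nlos k m' m l b a)).trans ?_
    by_cases hm : m = m'
    · subst hm
      by_cases hl : l ∈ S.copilot k <;>
      simp [hl, S.star_amp, hX.star_R]
    · simp [hm, Ne.symm hm]
  have h2 : ∫ ω, X.components k (Sum.inr m) ω a * star (S.pilotFluct X k m' b ω) ∂P =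
      if m = m' then ((τp * S.σ ^ 2 : ℝ) : ℂ) * (1 : Matrix (Fin N) (Fin N) ℂ) a b else 0 := by
    rw [integral_mul_star_comm]
    refine (congrArg star (hX.integral_pilotFluct_mul_star_noise k m' m b a)).trans ?_
    by_cases hm : m = m'
    · subst hm
      by_cases hab : a = b
      · subst hab
        simp
      · simp [hab, Ne.symm hab]
    · simp [hm, Ne.symm hm]
  simp only [h1, h2]
  by_cases hm : m = m'
  · simp only [hm, true_and, if_true, Network.Psi]
    rw [Finset.sum_congr rfl fun l hl => by rw [if_pos hl, ← mul_assoc, S.amp_mul_amp]]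
    simp only [Matrix.add_apply, Matrix.sum_apply, Matrix.smul_apply, smul_eq_mul, mul_add,
      Finset.mul_sum]
    push_cast
    congr 1
    · exact Finset.sum_congr rfl fun l _ => by ring
    · ring
  · simp [hm]

lemma integral_estFluct_mul (m : Fin M) (i : Fin N) {f : Ω → ℂ} (hf : FiniteMoments P f) :
    ∫ ω, S.estFluct X k m i ω * f ω ∂P =
      ∑ j, S.A m k i j * ∫ ω, S.pilotFluct X k m j ω * f ω ∂P :=
  integral_sum_const_mul_mul _ _
    (fun j _ => (isFunctionalOf_pilotFluct k m j).finiteMoments (hX.hasGaussianLaw k)) hf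

/-- Circular symmetry: without a conjugate nothing correlates. -/
lemma integral_nlos_mul_estFluct (m m' : Fin M) (l : Fin K) (i j : Fin N) :
    ∫ ω, X.nlos m l ω i * S.estFluct X k m' j ω ∂P = 0 := by
  have hf := (isFunctionalOf_nlos (X := X) k m l i).finiteMoments (hX.hasGaussianLaw k)
  simp_rw [mul_comm (X.nlos m l _ i)]
  rw [hX.integral_estFluct_mul k m' j hf]
  simp [hX.integral_pilotFluct_mul_nlos k]

/-- Pilot contamination enters here: the estimate for `k` contains the channel of `l` only if both
send the same pilot, and only at the same access point. -/
lemma integral_nlos_mul_star_estFluct (m m' : Fin M) (l : Fin K) (i j : Fin N) :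
    ∫ ω, X.nlos m l ω i * star (S.estFluct X k m' j ω) ∂P =
      if m = m' ∧ l ∈ S.copilot k then S.amp l * (S.R m l * (S.A m k)ᴴ) i j else 0 := by
  have hf := (isFunctionalOf_nlos (X := X) k m l i).star.finiteMoments (hX.hasGaussianLaw k)
  rw [integral_mul_star_comm, hX.integral_estFluct_mul k m' j hf]
  simp only [hX.integral_pilotFluct_mul_star_nlos k, eq_comm (a := m')]
  split_ifs with h
  · obtain ⟨rfl, -⟩ := h
    rw [star_sum, Matrix.mul_apply, Finset.mul_sum]
    refine Finset.sum_congr rfl fun n _ => ?_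
    rw [star_mul', star_mul', S.star_amp, hX.star_R, conjTranspose_apply]
    ring
  · simp

lemma integral_estFluct_mul_star (m m' : Fin M) (i j : Fin N) :
    ∫ ω, S.estFluct X k m i ω * star (S.estFluct X k m' j ω) ∂P =
      if m = m' then (τp : ℂ) * S.APA m k i j else 0 := by
  have hfun := fun m j => isFunctionalOf_estFluct (S := S) (X := X) k m j
  have hf := (hfun m' j).star.finiteMoments (hX.hasGaussianLaw k)
  have hpf := fun n => (isFunctionalOf_pilotFluct (S := S) (X := X) k m n).star.finiteMoments
    (hX.hasGaussianLaw k)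
  rw [hX.integral_estFluct_mul k m i hf]
  have h : ∀ n, ∫ ω, S.pilotFluct X k m n ω * star (S.estFluct X k m' j ω) ∂P =
      if m = m' then (τp : ℂ) * (S.Psi m k * (S.A m k)ᴴ) n j else 0 := fun n => by
    rw [integral_mul_star_comm, hX.integral_estFluct_mul k m' j (hpf n), star_sum]
    simp_rw [star_mul', ← integral_mul_star_comm, hX.integral_pilotFluct_mul_star k]
    split_ifs with h
    · subst h
      rw [Matrix.mul_apply, Finset.mul_sum]
      refine Finset.sum_congr rfl fun n' _ => ?_
      rw [conjTranspose_apply]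
      ring
    · simp
  simp_rw [h, Network.APA]
  split_ifs
  · rw [Matrix.mul_assoc, Matrix.mul_apply, Finset.mul_sum]
    exact Finset.sum_congr rfl fun _ _ => by ring
  · simp

end Covariance

/-! ### Moments of channels and estimates, and the closed form of the OBE matrix -/

section Moments

variable [IsProbabilityMeasure P] (hX : IsModel P S X) (k : Fin K)
include hX

lemma finiteMoments_g (m : Fin M) (l : Fin K) (i : Fin N) :
    FiniteMoments P fun ω => S.g X m l ω i :=
  (FiniteMoments.const _).add ((isFunctionalOf_nlos l m l i).finiteMoments (hX.hasGaussianLaw l))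

lemma finiteMoments_ghat (m : Fin M) (i : Fin N) : FiniteMoments P fun ω => S.ghat X m k ω i := by
  simp_rw [S.ghat_apply]
  exact (FiniteMoments.const _).add
    ((isFunctionalOf_estFluct k m i).finiteMoments (hX.hasGaussianLaw k))

lemma finiteMoments_q (l : Fin K) (i : Idx M N) : FiniteMoments P fun ω => S.q X k l ω i :=
  (hX.finiteMoments_g _ _ _).mul (hX.finiteMoments_ghat k _ _).star

lemma integral_g_mul_star_ghat (m : Fin M) (l : Fin K) (i j : Fin N) :
    ∫ ω, S.g X m l ω i * star (S.ghat X m k ω j) ∂P =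
      if l ∈ S.copilot k then S.B m l k i j else S.Gbar m l k i j := by
  simp_rw [S.ghat_apply, S.g_apply, star_add]
  rw [(isFunctionalOf_nlos k m l i).integral_const_add_mul_two (isFunctionalOf_estFluct k m j).star
    (hX.hasGaussianLaw k) (hX.integral_functional k), hX.integral_nlos_mul_star_estFluct k]
  split_ifs with h1 h2 h2
  · rfl
  · exact absurd h1.2 h2
  · exact absurd ⟨rfl, h2⟩ h1
  · exact add_zero _

lemma integral_g_mul_star_g (m m' : Fin M) (l : Fin K) (i j : Fin N) :
    ∫ ω, S.g X m l ω i * star (S.g X m' l ω j) ∂P =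
      S.los m l i * star (S.los m' l j) + if m = m' then S.R m l i j else 0 := by
  simp_rw [S.g_apply, star_add]
  rw [(isFunctionalOf_nlos l m l i).integral_const_add_mul_two (isFunctionalOf_nlos l m' l j).star
    (hX.hasGaussianLaw l) (hX.integral_functional l)]
  have := hX.integral_component_mul_star l (Sum.inl (m, l)) (Sum.inl (m', l)) i j
  simp only [Randomness.components, Sum.elim_inl, Sum.inl.injEq, Prod.mk.injEq, and_true,
    Network.componentCov] at this
  rw [this]

lemma integral_ghat_mul_star_ghat (m m' : Fin M) (i j : Fin N) :
    ∫ ω, S.ghat X m k ω i * star (S.ghat X m' k ω j) ∂P =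
      S.los m k i * star (S.los m' k j) + if m = m' then (τp : ℂ) * S.APA m k i j else 0 := by
  simp_rw [S.ghat_apply, star_add]
  rw [(isFunctionalOf_estFluct k m i).integral_const_add_mul_two
    (isFunctionalOf_estFluct k m' j).star (hX.hasGaussianLaw k) (hX.integral_functional k),
    hX.integral_estFluct_mul_star k]

lemma integral_g_mul_ghat (m m' : Fin M) (l : Fin K) (i j : Fin N) :
    ∫ ω, S.g X m l ω i * S.ghat X m' k ω j ∂P = S.los m l i * S.los m' k j := by
  simp_rw [S.ghat_apply, S.g_apply]
  rw [(isFunctionalOf_nlos k m l i).integral_const_add_mul_two (isFunctionalOf_estFluct k m' j)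
    (hX.hasGaussianLaw k) (hX.integral_functional k), hX.integral_nlos_mul_estFluct k, add_zero]

/-- Isserlis with means for `g`, `ĝ*`, `g*`, `ĝ`. The pairing of `g` with `ĝ` equals the product of
means, so only one of the two subtracted copies survives. -/
lemma integral_q_mul_star_q (l : Fin K) (i j i' j' : Fin N) (m m' : Fin M) :
    ∫ ω, S.q X k l ω ((j, i), m) * star (S.q X k l ω ((j', i'), m')) ∂P =
      (if l ∈ S.copilot k then S.B m l k i j else S.Gbar m l k i j)
        * star (if l ∈ S.copilot k then S.B m' l k i' j' else S.Gbar m' l k i' j')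
      + (S.los m l i * star (S.los m' l i') + if m = m' then S.R m l i i' else 0)
        * (S.los m' k j' * star (S.los m k j) + if m' = m then (τp : ℂ) * S.APA m' k j' j else 0)
      - S.los m l i * star (S.los m k j) * star (S.los m' l i') * S.los m' k j' := by
  have key := IsFunctionalOf.integral_const_add_mul_four (isFunctionalOf_nlos (X := X) k m l i)
    (isFunctionalOf_estFluct (S := S) k m j).star (isFunctionalOf_nlos k m' l i').star
    (isFunctionalOf_estFluct (S := S) k m' j') (hX.hasGaussianLaw k) (hX.integral_functional k)
    (S.los m l i) (star (S.los m k j)) (star (S.los m' l i')) (S.los m' k j')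
  simp_rw [← star_add, ← S.g_apply, ← S.ghat_apply] at key
  rw [hX.integral_g_mul_star_ghat k, hX.integral_g_mul_star_g, hX.integral_g_mul_ghat k] at key
  have e1 : ∫ ω, star (S.g X m' l ω i') * S.ghat X m' k ω j' ∂P =
      star (∫ ω, S.g X m' l ω i' * star (S.ghat X m' k ω j') ∂P) := by
    rw [← integral_mul_star_comm]
    simp_rw [mul_comm]
  have e2 : ∫ ω, star (S.ghat X m k ω j) * S.ghat X m' k ω j' ∂P =
      ∫ ω, S.ghat X m' k ω j' * star (S.ghat X m k ω j) ∂P := by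
    simp_rw [mul_comm]
  have e3 : ∫ ω, star (S.ghat X m k ω j) * star (S.g X m' l ω i') ∂P =
      star (∫ ω, S.g X m' l ω i' * S.ghat X m k ω j ∂P) := by
    refine Eq.trans ?_ (integral_conj (f := fun ω => S.g X m' l ω i' * S.ghat X m k ω j) (μ := P))
    congr with ω
    simp [mul_comm]
  rw [e1, e2, e3, hX.integral_g_mul_star_ghat k, hX.integral_g_mul_ghat k,
    hX.integral_ghat_mul_star_ghat k] at key
  have : ∫ ω, S.q X k l ω ((j, i), m) * star (S.q X k l ω ((j', i'), m')) ∂P =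
      ∫ ω, S.g X m l ω i * star (S.ghat X m k ω j) * star (S.g X m' l ω i')
        * S.ghat X m' k ω j' ∂P := by
    congr with ω
    simp only [S.q_apply, star_mul', star_star]
    ring
  rw [this, key, star_mul']
  ring

lemma expVec_pvec : expVec P (S.pvec X k) = S.rbar k := by
  ext ⟨⟨j, i⟩, m⟩
  refine (hX.integral_g_mul_star_ghat k m k i j).trans ?_
  rw [if_pos (by simp [Network.copilot])]
  rfl

lemma Xi_eq : S.Xi X P k = S.Gamma5 k := by
  rw [Network.Xi, Network.Gamma5]
  congr with m : 2
  congr 1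
  ext i j
  refine (hX.integral_ghat_mul_star_ghat k m m j i).trans ?_
  simp [Network.Gbar, outer, vecMulVec_apply]

/-- In a diagonal block `Γ³` and `Γ⁴` vanish, the Kronecker terms form `Γ¹`, and for a shared pilot
`Γ²` is the expansion of `b bᴴ - ḡ ḡᴴ`. Off the diagonal only products of means remain: `ḡ ḡᴴ`,
corrected by `Γ⁴` to `b bᴴ` when the pilot is shared. -/
lemma smul_expMat_outer_q (l : Fin K) :
    (S.p l : ℂ) • expMat P (fun ω => outer (S.q X k l ω) (S.q X k l ω)) =
      S.Gamma1 k l + S.Gamma3 k l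
        + if l ∈ S.copilot k then S.Gamma2 k l + S.Gamma4 k l else 0 := by
  ext ⟨⟨j, i⟩, m⟩ ⟨⟨j', i'⟩, m'⟩
  have h : expMat P (fun ω => outer (S.q X k l ω) (S.q X k l ω)) ((j, i), m) ((j', i'), m') =
    ∫ ω, S.q X k l ω ((j, i), m) * star (S.q X k l ω ((j', i'), m')) ∂P := rfl
  rw [Matrix.smul_apply, h, hX.integral_q_mul_star_q k]
  have ha := S.amp_mul_amp l
  push_cast at ha
  by_cases hm : m = m'
  · subst hm
    by_cases hl : l ∈ S.copilot k
    · simp [hl, Network.Gamma1, Network.Gamma2, Network.Gamma3, Network.Gamma4, blockDiagonal_apply,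
        outer, vecMulVec_apply, stack, Network.gvec, Network.rtil, Network.bvec, vec, Network.B,
        Network.Gbar, kroneckerMap_apply, S.star_amp]
      -- The two sides differ only in the term quadratic in `Ř Aᴴ`, where `amp²` has to be read as
      -- `p_l τp²`.
      linear_combination (S.p l : ℂ) * (S.R m l * (S.A m k)ᴴ) i j
        * (starRingEnd ℂ) ((S.R m l * (S.A m k)ᴴ) i' j') * ha
    · simp [hl, Network.Gamma1, Network.Gamma3, blockDiagonal_apply,
        outer, vecMulVec_apply, stack, Network.gvec, vec, Network.Gbar, kroneckerMap_apply]
      ring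
  · by_cases hl : l ∈ S.copilot k
    · simp [hl, hm, Ne.symm hm, Network.Gamma1, Network.Gamma2, Network.Gamma3, Network.Gamma4,
        blockDiagonal_apply, outer, vecMulVec_apply, stack, Network.gvec, Network.rtil,
        Network.bvec, vec, Network.B, Network.Gbar]
      ring
    · simp [hl, hm, Ne.symm hm, Network.Gamma1, Network.Gamma3, blockDiagonal_apply,
        outer, vecMulVec_apply, stack, Network.gvec, vec, Network.Gbar]
      -- Simplification has cancelled the factor `p_l`, leaving a disjunction with `p_l = 0`.
      exact Or.inl (by ring)

lemma obeMatrix_eq : S.obeMatrix X P k = S.obeMatrixClosed k := by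
  rw [Network.obeMatrix, Network.obeMatrixClosed, hX.expVec_pvec k, hX.Xi_eq k]
  simp_rw [hX.smul_expMat_outer_q k, Finset.sum_add_distrib, Finset.sum_ite_mem, Finset.univ_inter,
    Finset.sum_add_distrib]

end Moments

end IsModel

/-! ### Maximum of the generalized Rayleigh quotient -/

section GeneralizedRayleighQuotient

open scoped ComplexOrder

variable {ι : Type*} [Fintype ι] {D : Matrix ι ι ℂ}

lemma star_dotProduct_mulVec_comm (hD : D.IsHermitian) (x y : ι → ℂ) :
    star (star x ⬝ᵥ (D *ᵥ y)) = star y ⬝ᵥ (D *ᵥ x) := by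
  rw [star_dotProduct, star_star, star_mulVec, hD.eq, ← dotProduct_mulVec]

variable (hD : D.PosSemidef) {u r : ι → ℂ} (hu : D *ᵥ u = r)
include hD hu

lemma star_dotProduct_comm_of_mulVec_eq : star u ⬝ᵥ r = star r ⬝ᵥ u := by
  rw [← hu, star_mulVec, hD.isHermitian.eq, ← dotProduct_mulVec]

/-- The number is `uᴴ D u` with `D` Hermitian, hence real. -/
lemma ofReal_re_star_dotProduct : ((star r ⬝ᵥ u).re : ℂ) = star r ⬝ᵥ u := by
  refine Complex.conj_eq_iff_re.1 ?_
  rw [← star_dotProduct_comm_of_mulVec_eq hD hu, ← hu]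
  exact star_dotProduct_mulVec_comm hD.isHermitian u u

lemma re_star_dotProduct_nonneg : 0 ≤ (star r ⬝ᵥ u).re := by
  rw [← star_dotProduct_comm_of_mulVec_eq hD hu, ← hu]
  exact (Complex.nonneg_iff.1 (hD.dotProduct_mulVec_nonneg u)).1

/-- The Cauchy-Schwarz inequality for the sesquilinear form of a positive semidefinite matrix. -/
lemma norm_sq_dotProduct_le (hpos : u = 0 ∨ 0 < (star r ⬝ᵥ u).re) (w : ι → ℂ) :
    ‖star w ⬝ᵥ r‖ ^ 2 ≤ (star r ⬝ᵥ u).re * (star w ⬝ᵥ (D *ᵥ w)).re := by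
  rcases hpos with rfl | hb
  · simp [← hu]
  set b := (star r ⬝ᵥ u).re with hbdef
  set c := star w ⬝ᵥ r with hc
  have hbu : star u ⬝ᵥ (D *ᵥ u) = b := by
    rw [hu, star_dotProduct_comm_of_mulVec_eq hD hu, ofReal_re_star_dotProduct hD hu]
  have hcu : star u ⬝ᵥ (D *ᵥ w) = star c := by
    rw [hc, ← hu, star_dotProduct_mulVec_comm hD.isHermitian]
  -- The test vector is `b` times the residual of the `D`-orthogonal projection of `w` onto `u`; its
  -- form value is `b (b wᴴ D w - |c|²)`.
  have h := (Complex.nonneg_iff.1 (hD.dotProduct_mulVec_nonneg ((b : ℂ) • w - star c • u))).1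
  have e : star ((b : ℂ) • w - star c • u) ⬝ᵥ (D *ᵥ ((b : ℂ) • w - star c • u)) =
      (b : ℂ) * ((b : ℂ) * (star w ⬝ᵥ (D *ᵥ w)) - c * star c) := by
    have hbs : star (b : ℂ) = b := Complex.conj_ofReal b
    rw [star_sub, star_smul, star_smul, mulVec_sub, mulVec_smul, mulVec_smul, sub_dotProduct,
      dotProduct_sub, dotProduct_sub]
    simp only [smul_dotProduct, dotProduct_smul, hbu, hcu, hbs, star_star, smul_eq_mul]
    rw [hu, ← hc]
    ring
  have e2 : c * star c = ((‖c‖ ^ 2 : ℝ) : ℂ) := by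
    rw [← Complex.normSq_eq_norm_sq, ← Complex.mul_conj]
    rfl
  rw [e, e2, Complex.re_ofReal_mul, Complex.sub_re, Complex.re_ofReal_mul, Complex.ofReal_re] at h
  exact sub_nonneg.1 (nonneg_of_mul_nonneg_right h hb)

/-- The generalized Rayleigh quotient `|wᴴ r|² / (wᴴ D w)` is at most `rᴴ D⁻¹ r`. -/
lemma norm_sq_div_le [DecidableEq ι] (hdet : IsUnit D.det) (w : ι → ℂ) :
    ‖star w ⬝ᵥ r‖ ^ 2 / (star w ⬝ᵥ (D *ᵥ w)).re ≤ (star r ⬝ᵥ u).re := by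
  -- This form of the bound admits a zero denominator, where the quotient is `0`; hence the
  -- nonnegativity of the right-hand side.
  refine div_le_of_le_mul₀ (Complex.nonneg_iff.1 (hD.dotProduct_mulVec_nonneg w)).1
    (re_star_dotProduct_nonneg hD hu) (norm_sq_dotProduct_le hD hu ?_ w)
  -- Semidefinite and invertible means definite, so `uᴴ D u > 0` unless `u = 0`.
  have hpd : D.PosDef := hD.posDef_iff_det_ne_zero.2 hdet.ne_zero
  refine or_iff_not_imp_left.2 fun h0 => ?_
  rw [← star_dotProduct_comm_of_mulVec_eq hD hu, ← hu]
  exact (Complex.pos_iff.1 (hpd.dotProduct_mulVec_pos h0)).1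

/-- The generalized Rayleigh quotient attains the value `rᴴ D⁻¹ r` at `D⁻¹ r`. -/
lemma norm_sq_div_eq :
    ‖star u ⬝ᵥ r‖ ^ 2 / (star u ⬝ᵥ (D *ᵥ u)).re = (star r ⬝ᵥ u).re := by
  rw [hu, star_dotProduct_comm_of_mulVec_eq hD hu]
  conv_lhs => rw [← ofReal_re_star_dotProduct hD hu]
  rw [Complex.norm_real, Real.norm_eq_abs, sq_abs, sq, Complex.ofReal_re, mul_self_div_self]

end GeneralizedRayleighQuotient

/-! ### Quadratic forms of second-moment matrices -/

section SecondMoments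

variable {Ω ι : Type*} [MeasurableSpace Ω] {P : Measure Ω}

lemma isHermitian_expMat_outer (x : Ω → ι → ℂ) :
    (expMat P fun ω => outer (x ω) (x ω)).IsHermitian := by
  ext i j
  exact (integral_mul_star_comm (fun ω => x ω i) fun ω => x ω j).symm

lemma isHermitian_outer (x : ι → ℂ) : (outer x x).IsHermitian := by
  ext i j
  simp [outer, vecMulVec_apply, mul_comm]

variable [Fintype ι]

lemma star_dotProduct_outer_mulVec (w x : ι → ℂ) :
    star w ⬝ᵥ (outer x x *ᵥ w) = ((‖star w ⬝ᵥ x‖ ^ 2 : ℝ) : ℂ) := by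
  have : star x ⬝ᵥ w = star (star w ⬝ᵥ x) := by simp [dotProduct, mul_comm]
  rw [outer, vecMulVec_mulVec, dotProduct_smul, this]
  simp only [MulOpposite.smul_eq_mul_unop, MulOpposite.unop_op]
  rw [← Complex.normSq_eq_norm_sq, ← Complex.mul_conj]
  rfl

lemma star_dotProduct_expMat_outer_mulVec {x : Ω → ι → ℂ}
    (hx : ∀ i, FiniteMoments P fun ω => x ω i) (w : ι → ℂ) :
    star w ⬝ᵥ ((expMat P fun ω => outer (x ω) (x ω)) *ᵥ w) =
      ((∫ ω, ‖star w ⬝ᵥ x ω‖ ^ 2 ∂P : ℝ) : ℂ) := by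
  rw [← integral_complex_ofReal]
  simp_rw [← star_dotProduct_outer_mulVec, dotProduct, mulVec, dotProduct, expMat, outer,
    vecMulVec_apply, of_apply, Finset.mul_sum]
  have hi : ∀ i j, Integrable (fun ω => star w i * (x ω i * star (x ω) j * w j)) P := fun i j =>
    ((((hx i).mul (hx j).star).integrable.mul_const _).const_mul _)
  rw [integral_finsetSum _ fun i _ => integrable_finsetSum _ fun j _ => hi i j]
  refine Finset.sum_congr rfl fun i _ => ?_
  rw [integral_finsetSum _ fun j _ => hi i j]
  refine Finset.sum_congr rfl fun j _ => ?_
  rw [integral_const_mul, integral_mul_const]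

lemma finiteMoments_dotProduct {x : Ω → ι → ℂ} (hx : ∀ i, FiniteMoments P fun ω => x ω i)
    (w : ι → ℂ) : FiniteMoments P fun ω => w ⬝ᵥ x ω :=
  FiniteMoments.sum _ fun i _ => (hx i).const_mul _

lemma integral_dotProduct {x : Ω → ι → ℂ} (hx : ∀ i, FiniteMoments P fun ω => x ω i)
    (w : ι → ℂ) : ∫ ω, w ⬝ᵥ x ω ∂P = w ⬝ᵥ expVec P x := by
  simp_rw [dotProduct]
  rw [integral_finsetSum _ fun i _ => ((hx i).const_mul _).integrable]
  simp_rw [integral_const_mul, expVec]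

/-- The variance of `‖f‖` is nonnegative, and `‖E f‖ ≤ E ‖f‖`. -/
lemma norm_integral_sq_le [IsProbabilityMeasure P] {f : Ω → ℂ} (hf : MemLp f 2 P) :
    ‖∫ ω, f ω ∂P‖ ^ 2 ≤ ∫ ω, ‖f ω‖ ^ 2 ∂P := by
  have h1 := variance_nonneg (fun ω => ‖f ω‖) P
  rw [variance_eq_sub hf.norm] at h1
  calc _ ≤ (∫ ω, ‖f ω‖ ∂P) ^ 2 := by gcongr; exact norm_integral_le_integral_norm f
    _ ≤ _ := sub_nonneg.1 h1

end SecondMoments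

/-! ### The uplink SINR as a generalized Rayleigh quotient -/

variable {Ω : Type*} {M K N τp : ℕ}

/-- Lets the maximum over equalizer matrices be taken over stacked vectors. -/
lemma unvec_surjective : Function.Surjective (unvec (M := M) (N := N)) := fun W =>
  ⟨fun i => W i.2 i.1.2 i.1.1, rfl⟩

namespace Network

variable (S : Network M K N τp) (X : Randomness Ω M K N)

/-- The trace identity `(W ĝ)ᴴ g = tr(Wᴴ g ĝᴴ)`, summed over the access points. -/
lemma sum_combiner_dotProduct_g (k l : Fin K) (w : Idx M N → ℂ) (ω : Ω) :
    ∑ m, star (S.combiner X k (unvec w) m ω) ⬝ᵥ S.g X m l ω = star w ⬝ᵥ S.q X k l ω := by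
  simp_rw [dotProduct, combiner, Fintype.sum_prod_type_right, unvec, q_apply]
  refine Finset.sum_congr rfl fun m _ => Finset.sum_congr rfl fun i _ => ?_
  rw [Pi.star_apply, mulVec, dotProduct, star_sum, Finset.sum_mul]
  refine Finset.sum_congr rfl fun j _ => ?_
  rw [of_apply, star_mul', Pi.star_apply]
  ring

end Network

namespace IsModel

variable [MeasurableSpace Ω] {P : Measure Ω} {S : Network M K N τp} {X : Randomness Ω M K N}
variable [IsProbabilityMeasure P] (hX : IsModel P S X) (k : Fin K)
include hX

lemma finiteMoments_combiner (w : Idx M N → ℂ) (m : Fin M) (i : Fin N) :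
    FiniteMoments P fun ω => S.combiner X k (unvec w) m ω i :=
  finiteMoments_dotProduct (fun j => hX.finiteMoments_ghat k m j) _

lemma sum_integral_combiner_dotProduct_g (w : Idx M N → ℂ) :
    ∑ m, ∫ ω, star (S.combiner X k (unvec w) m ω) ⬝ᵥ S.g X m k ω ∂P =
      star w ⬝ᵥ expVec P (S.pvec X k) := by
  rw [← integral_finsetSum]
  · simp_rw [S.sum_combiner_dotProduct_g X]
    exact integral_dotProduct (hX.finiteMoments_q k k) _
  · exact fun m _ => (FiniteMoments.sum _ fun i _ =>
      (hX.finiteMoments_combiner k w m i).star.mul (hX.finiteMoments_g m k i)).integrable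

lemma star_dotProduct_Xi_mulVec (w : Idx M N → ℂ) :
    star w ⬝ᵥ (S.Xi X P k *ᵥ w) =
      ((∑ m, ∫ ω, ∑ i, ‖S.combiner X k (unvec w) m ω i‖ ^ 2 ∂P : ℝ) : ℂ) := by
  have hint : ∀ m, ∫ ω, ∑ i, ‖S.combiner X k (unvec w) m ω i‖ ^ 2 ∂P =
      ∑ i, ∫ ω, ‖S.combiner X k (unvec w) m ω i‖ ^ 2 ∂P := fun m =>
    integral_finsetSum _ fun i _ => (hX.finiteMoments_combiner k w m i).memLp_two.integrable_norm_pow'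
  -- Entry `i` of `W ĝ` pairs row `i` of `W` with `ĝ` without conjugation, so the second moment of
  -- the conjugate of `ĝ` appears; this is the transpose in `Ξ`.
  have hrow : ∀ m i, ((∫ ω, ‖S.combiner X k (unvec w) m ω i‖ ^ 2 ∂P : ℝ) : ℂ) =
      star (fun j => w ((j, i), m)) ⬝ᵥ ((expMat P fun ω => outer (star (S.ghat X m k ω))
        (star (S.ghat X m k ω))) *ᵥ fun j => w ((j, i), m)) := fun m i => by
    rw [star_dotProduct_expMat_outer_mulVec (x := fun ω => star (S.ghat X m k ω))
      fun j => (hX.finiteMoments_ghat k m j).star]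
    congr with ω
    rw [star_dotProduct_star, norm_star, dotProduct_comm]
    rfl
  simp_rw [hint]
  push_cast
  simp_rw [hrow, dotProduct, mulVec, dotProduct, Fintype.sum_prod_type_right]
  refine Finset.sum_congr rfl fun m _ => Finset.sum_congr rfl fun i _ =>
    Finset.sum_congr rfl fun j _ => ?_
  -- The block diagonal form removes the other access points, and the factor `I_N` the other rows.
  rw [Finset.sum_eq_single m, Finset.sum_eq_single i]
  · refine congrArg _ (Finset.sum_congr rfl fun j' _ => ?_)
    simp [Network.Xi, blockDiagonal_apply, expMat, outer, vecMulVec_apply, mul_comm]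
  · intro i' _ hi
    simp [Network.Xi, blockDiagonal_apply, Ne.symm hi]
  · simp
  · intro m' _ hm
    simp [Network.Xi, blockDiagonal_apply, Ne.symm hm]
  · simp

lemma star_dotProduct_obeMatrix_mulVec (w : Idx M N → ℂ) :
    star w ⬝ᵥ (S.obeMatrix X P k *ᵥ w) =
      ((∑ l, S.p l * ∫ ω, ‖∑ m, star (S.combiner X k (unvec w) m ω) ⬝ᵥ S.g X m l ω‖ ^ 2 ∂P
      - S.p k * ‖∑ m, ∫ ω, star (S.combiner X k (unvec w) m ω) ⬝ᵥ S.g X m k ω ∂P‖ ^ 2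
      + S.σ ^ 2 * ∑ m, ∫ ω, ∑ i, ‖S.combiner X k (unvec w) m ω i‖ ^ 2 ∂P : ℝ) : ℂ) := by
  simp_rw [hX.sum_integral_combiner_dotProduct_g k, S.sum_combiner_dotProduct_g X]
  rw [Network.obeMatrix, add_mulVec, sub_mulVec, sum_mulVec, dotProduct_add, dotProduct_sub,
    dotProduct_sum]
  simp_rw [smul_mulVec, dotProduct_smul, hX.star_dotProduct_Xi_mulVec k,
    star_dotProduct_expMat_outer_mulVec (hX.finiteMoments_q k _), star_dotProduct_outer_mulVec,
    smul_eq_mul]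
  push_cast
  rfl

lemma sinr_combiner_unvec (w : Idx M N → ℂ) :
    S.sinr X P k (S.combiner X k (unvec w)) = S.p k *
      (‖star w ⬝ᵥ expVec P (S.pvec X k)‖ ^ 2 / (star w ⬝ᵥ (S.obeMatrix X P k *ᵥ w)).re) := by
  rw [hX.star_dotProduct_obeMatrix_mulVec k, Complex.ofReal_re,
    ← hX.sum_integral_combiner_dotProduct_g k, ← mul_div_assoc]
  rfl

open scoped ComplexOrder in
-- The quadratic form is the SINR denominator. The subtracted signal power is at most the `l = k`
-- term of the sum, by Jensen, and all other terms are nonnegative.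
lemma posSemidef_obeMatrix : (S.obeMatrix X P k).PosSemidef := by
  refine .of_dotProduct_mulVec_nonneg ?_ fun w => ?_
  · have hr : ∀ x : ℝ, IsSelfAdjoint (x : ℂ) := fun x => Complex.conj_ofReal x
    have hXi : (S.Xi X P k).IsHermitian := by
      rw [IsHermitian, Network.Xi, blockDiagonal_conjTranspose]
      congr with m : 2
      rw [conjTranspose_kronecker, conjTranspose_one, (isHermitian_expMat_outer _).transpose.eq]
    refine ((isSelfAdjoint_sum _ fun l _ => ?_).sub ?_).add ?_
    · exact (isHermitian_expMat_outer _).smul (hr _)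
    · exact (isHermitian_outer _).smul (hr _)
    · exact hXi.smul (hr _)
  · rw [hX.star_dotProduct_obeMatrix_mulVec k, Complex.zero_le_real]
    have h0 : ∀ l, 0 ≤ S.p l *
        ∫ ω, ‖∑ m, star (S.combiner X k (unvec w) m ω) ⬝ᵥ S.g X m l ω‖ ^ 2 ∂P := fun l =>
      mul_nonneg (S.p_nonneg l) (integral_nonneg fun _ => by positivity)
    have h1 := Finset.single_le_sum (fun l _ => h0 l) (Finset.mem_univ k)
    have h2 : ‖∑ m, ∫ ω, star (S.combiner X k (unvec w) m ω) ⬝ᵥ S.g X m k ω ∂P‖ ^ 2 ≤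
        ∫ ω, ‖∑ m, star (S.combiner X k (unvec w) m ω) ⬝ᵥ S.g X m k ω‖ ^ 2 ∂P := by
      rw [hX.sum_integral_combiner_dotProduct_g k]
      simp_rw [S.sum_combiner_dotProduct_g X]
      refine (congrArg (fun z => ‖z‖ ^ 2)
        (integral_dotProduct (hX.finiteMoments_q k k) (star w))).symm.trans_le ?_
      exact norm_integral_sq_le (finiteMoments_dotProduct (hX.finiteMoments_q k k) _).memLp_two
    have h3 := mul_le_mul_of_nonneg_left h2 (S.p_nonneg k)
    have h4 : 0 ≤ S.σ ^ 2 * ∑ m, ∫ ω, ∑ i, ‖S.combiner X k (unvec w) m ω i‖ ^ 2 ∂P :=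
      mul_nonneg (sq_nonneg _) (Finset.sum_nonneg fun m _ => integral_nonneg fun _ => by positivity)
    linarith

end IsModel

end CellFree

theorem theorem2 {Ω : Type*} [MeasurableSpace Ω] (P : MeasureTheory.Measure Ω)
    [MeasureTheory.IsProbabilityMeasure P] {M K N τp : ℕ}
    (S : CellFree.Network M K N τp) (X : CellFree.Randomness Ω M K N)
    (hX : CellFree.IsModel P S X) (k : Fin K) :
    (∀ m i, MeasureTheory.MemLp (fun ω => S.ghat X m k ω i) 2 P) ∧
    (∀ l i, MeasureTheory.MemLp (fun ω => S.q X k l ω i) 2 P) ∧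
    CellFree.expVec P (S.pvec X k) = S.rbar k ∧
    S.obeMatrix X P k = S.obeMatrixClosed k ∧
    (IsUnit (S.obeMatrixClosed k).det →
      S.obe X P k = S.obeClosed k ∧
      S.sinrStar X P k = (S.p k : ℂ) * (star (S.rbar k) ⬝ᵥ S.obeClosed k) ∧
      IsGreatest
        (Set.range fun W : Fin M → Matrix (Fin N) (Fin N) ℂ => S.sinr X P k (S.combiner X k W))
        (S.sinr X P k (S.combiner X k (CellFree.unvec (S.obeClosed k)))) ∧
      ((S.sinr X P k (S.combiner X k (CellFree.unvec (S.obeClosed k))) : ℝ) : ℂ) =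
        (S.p k : ℂ) * (star (S.rbar k) ⬝ᵥ S.obeClosed k)) := by
  have hr := hX.expVec_pvec k
  have hD := hX.obeMatrix_eq k
  refine ⟨fun m i => (hX.finiteMoments_ghat k m i).memLp_two,
    fun l i => (hX.finiteMoments_q k l i).memLp_two, hr, hD, fun hdet => ?_⟩
  have hpsd := hX.posSemidef_obeMatrix k
  have hsinr := hX.sinr_combiner_unvec k
  rw [hD] at hpsd
  simp_rw [hr, hD] at hsinr
  have hu : S.obeMatrixClosed k *ᵥ S.obeClosed k = S.rbar k := by
    rw [CellFree.Network.obeClosed, mulVec_mulVec, mul_nonsing_inv _ hdet, one_mulVec]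
  have hval : S.sinr X P k (S.combiner X k (CellFree.unvec (S.obeClosed k))) =
      S.p k * (star (S.rbar k) ⬝ᵥ S.obeClosed k).re := by
    rw [hsinr, CellFree.norm_sq_div_eq hpsd hu]
  refine ⟨?_, ?_, ⟨⟨_, rfl⟩, ?_⟩, ?_⟩
  · rw [CellFree.Network.obe, hr, hD, CellFree.Network.obeClosed]
  · rw [CellFree.Network.sinrStar, hr, hD, CellFree.Network.obeClosed]
  · rintro _ ⟨W, rfl⟩
    obtain ⟨w, rfl⟩ := CellFree.unvec_surjective W
    rw [hval]
    exact (hsinr w).trans_le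
      (mul_le_mul_of_nonneg_left (CellFree.norm_sq_div_le hpsd hu hdet w) (S.p_nonneg k))
  -- The closed form is a complex number; it equals its real part because it is `p_k` times a value
  -- of a Hermitian form.
  · rw [hval, Complex.ofReal_mul, CellFree.ofReal_re_star_dotProduct hpsd hu]
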